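/- Consider a queue with Poisson arrivals of rate $\lambda>0$ and $K$ groups of servers. Group $k$ has $M_k$ servers with exponential service times of rate $\mu_k>0$, each costing $c_k\ge 0$ per unit of time while it is working. A holding cost $h(n)$ per unit of time is paid when $n$ customers are present, where $h$ is increasing and convex and $h(n)\to\infty$. An efficient policy $d$ prescribes, whenever $n$ customers are present, the number $d(n,k)\in\{0,\dots,M_k\}$ of working servers of each group $k$, with $\sum_k d(n,k)\le n$; the number of customers $n_t$ is then a birth-death process with birth rate $\lambda$ and death rate $\sum_k d(n,k)\mu_k$ in state $n$. The long-run average cost of $d$ is $$\eta^d=\lim_{T\to\infty}\mathbb E\Big\{\frac1T\int_0^T\Big[h(n_t)+\sum_{k=1}^K d(n_t,k)\,c_k\Big]dt\Big\},$$ and an optimal policy is an efficient policy whose long-run average cost is finite (and the same from every initial state) and minimal among all efficient policies. Assume scale economies: the groups are numbered so that $\frac{c_1}{\mu_1}\le\frac{c_2}{\mu_2}\le\cdots\le\frac{c_K}{\mu_K}$ and $\mu_1\ge\mu_2\ge\cdots\ge\mu_K$. Let $d^*$ be an optimal policy which resolves ties between groups with equal ratios by their numbering, that is, if $k<l$, $c_k/\mu_k=c_l/\mu_l$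 and $d^*(n,l)>0$, then $d^*(n,k)=M_k$. (If the ratios $c_k/\mu_k$ are pairwise different, this is no restriction.) Then $d^*(n,k)$ is nondecreasing in $n$ for every $k=1,\dots,K$; hence $d^*(n)=(d^*(n,1),\dots,d^*(n,K))$ is nondecreasing in $n$ in the componentwise order. Moreover, if there is an optimal policy, then there is one that resolves ties in this way. -/

import Mathlib

/-- The data of a group-server queue with `K` groups of servers (indexed by `Fin K`):
Poisson arrivals of rate `arrival`; group `k` has `servers k` exponential servers, each with
service rate `rate k` and operating cost `opCost k` per unit of time while it is working;
`hold n` is the holding cost per unit of time when `n` customers are present. -/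
structure GroupServerQueue (K : ℕ) where
  arrival : ℝ
  servers : Fin K → ℕ
  rate : Fin K → ℝ
  opCost : Fin K → ℝ
  hold : ℕ → ℝ
  arrival_pos : 0 < arrival
  rate_pos : ∀ k, 0 < rate k
  opCost_nonneg : ∀ k, 0 ≤ opCost k

namespace GroupServerQueue

variable {K : ℕ} (Q : GroupServerQueue K)

/-- The holding cost is increasing, convex and tends to infinity. -/
structure HoldingCostAssumption : Prop where
  increasing : Monotone Q.hold
  convex : ∀ n, Q.hold (n + 1) - Q.hold n ≤ Q.hold (n + 2) - Q.hold (n + 1)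
  tendsto : Filter.Tendsto Q.hold Filter.atTop Filter.atTop

/-- Scale economies: the groups are numbered in ascending order of the ratio `c / μ`, and in
this order the service rates are descending. -/
structure ScaleEconomies : Prop where
  ratio_ascending : ∀ k l, k ≤ l → Q.opCost k / Q.rate k ≤ Q.opCost l / Q.rate l
  rate_descending : ∀ k l, k ≤ l → Q.rate l ≤ Q.rate k

/-- An efficient stationary policy: `d n k` is the number of working servers of group `k` when
`n` customers are present; it is at most the size of the group, and the total number of working
servers is at most `n`. -/
def IsEfficient (d : ℕ → Fin K → ℕ) : Prop :=
  ∀ n, (∀ k, d n k ≤ Q.servers k) ∧ ∑ k, d n k ≤ n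

/-- The total service rate of the action `m`. -/
def serviceRate (m : Fin K → ℕ) : ℝ := ∑ k, (m k : ℝ) * Q.rate k

/-- The total cost rate in state `n` under the action `m`. -/
def costRate (n : ℕ) (m : Fin K → ℕ) : ℝ := Q.hold n + ∑ k, (m k : ℝ) * Q.opCost k

/-- Component `n` of the row vector `q B`, where `B` is the infinitesimal generator of the
number of customers under the policy `d`: a birth-death chain with birth rates `arrival` and
death rate `serviceRate (d n)` in state `n`. -/
def forward (d : ℕ → Fin K → ℕ) (q : ℕ → ℝ) : ℕ → ℝ
  | 0 => -Q.arrival * q 0 + Q.serviceRate (d 1) * q 1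
  | n + 1 => Q.arrival * q n - (Q.arrival + Q.serviceRate (d (n + 1))) * q (n + 1)
      + Q.serviceRate (d (n + 2)) * q (n + 2)

/-- `p t n` is the probability that `n` customers are present at time `t ≥ 0`, under the policy
`d` and with `i` customers at time `0`: the probability vectors `p t` solve the Kolmogorov
forward equation `p' = p B`. (All rates are bounded, so this determines `p t` for `t ≥ 0`.) -/
structure IsLaw (d : ℕ → Fin K → ℕ) (i : ℕ) (p : ℝ → ℕ → ℝ) : Prop where
  nonneg : ∀ t, 0 ≤ t → ∀ n, 0 ≤ p t n
  hasSum_one : ∀ t, 0 ≤ t → HasSum (p t) 1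
  initial : ∀ n, p 0 n = if n = i then 1 else 0
  kolmogorov : ∀ t, 0 ≤ t → ∀ n,
    HasDerivWithinAt (fun s => p s n) (Q.forward d (p t) n) (Set.Ici 0) t

/-- The long-run average cost of the policy `d` exists and is the real number `η`: from every
initial state, the expected cost up to time `T`, divided by `T`, is finite and tends to `η`. -/
def HasAverageCost (d : ℕ → Fin K → ℕ) (η : ℝ) : Prop :=
  ∀ i, ∃ p, Q.IsLaw d i p ∧
    (∀ t, 0 ≤ t → Summable fun n => p t n * Q.costRate n (d n)) ∧
    (∀ T, 0 ≤ T → IntervalIntegrable (fun t => ∑' n, p t n * Q.costRate n (d n))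
      MeasureTheory.volume 0 T) ∧
    Filter.Tendsto (fun T : ℝ => T⁻¹ * ∫ t in (0 : ℝ)..T, ∑' n, p t n * Q.costRate n (d n))
      Filter.atTop (nhds η)

/-- `d` is an optimal policy: it minimizes the (finite) long-run average cost over all efficient
policies. -/
def IsOptimal (d : ℕ → Fin K → ℕ) : Prop :=
  Q.IsEfficient d ∧ ∃ η, Q.HasAverageCost d η ∧
    ∀ d' η', Q.IsEfficient d' → Q.HasAverageCost d' η' → η ≤ η'

/-- Ties between groups with *equal* ratio `c / μ` are resolved by the numbering of the groups.
(This says nothing about groups with different ratios, and it holds for every policy if the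
ratios are pairwise different.) -/
def BreaksRatioTies (d : ℕ → Fin K → ℕ) : Prop :=
  ∀ n k l, k < l → Q.opCost k / Q.rate k = Q.opCost l / Q.rate l →
    0 < d n l → d n k = Q.servers k

end GroupServerQueue

/-! The problem is first made algebraic. If the average cost `η` is finite, limits of time averages
along an ultrafilter satisfy the balance equations, and `hold → ∞` prevents mass from escaping; so a
stationary distribution exists, of mean cost at most `η` (`HasAverageCost.exists_isStationary`).
Conversely, a stationary distribution of finite mean cost yields the average cost
(`IsStationary.hasAverageCost`), with a law built by uniformization. Optimality thus becomes
minimality of the stationary mean cost (`IsOptimalWith`).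

Let `G n`, here `valueDiff`, be the amount saved by a departure in state `n`. The performance
difference formula shows that an optimal action maximizes the linear function `∑ m k * (μ k * G n -
c k)` over the efficient actions in each recurrent state (`IsOptimalWith.gain_le`), which turns the
Poisson equation into an optimality equation for `G`.

The key fact is that `G` increases strictly from state 1 on (`valueDiff_lt_succ`). If it once failed
to, convexity of `hold` and the inequality `maxGain_add_le` would keep it nonincreasing for ever;
then `arrival * G (n + 1) = η - hold n + maxGain n (G n)` would tend to `-∞`, although `G` is
eventually nonnegative. The same argument shows that all states are recurrent (`IsOptimalWith.pos`).

Monotonicity follows by exchanging servers between the optimal actions of neighbouring states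
(`IsMaximizer.le_of_lt`): under scale economies a profitable group of smaller number gains at least
as much per server, with equality only for equal ratios, which the tie rule handles. Resolving ties
affects the service rate only where `G n` equals one of finitely many ratios, hence in finitely many
states, so the performance difference formula applies and shows that the cost is unchanged. -/

/-- The expectation of `a N` for a Poisson random variable `N` of mean `s`. -/
noncomputable def poissonMix (a : ℕ → ℝ) (s : ℝ) : ℝ :=
  Real.exp (-s) * ∑' k, a k * (s ^ k / (k.factorial : ℝ))

/-! ### Poisson mixtures of bounded sequences -/

section PoissonMix

variable {a b c : ℕ → ℝ} {C : ℝ}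

lemma summable_mul_pow_div_factorial (ha : ∀ k, |a k| ≤ C) (s : ℝ) :
    Summable fun k => a k * (s ^ k / (k.factorial : ℝ)) := by
  refine Summable.of_norm_bounded (g := fun k => C * (|s| ^ k / (k.factorial : ℝ)))
    ((Real.summable_pow_div_factorial |s|).mul_left C) fun k => ?_
  rw [norm_mul, Real.norm_eq_abs, Real.norm_eq_abs, abs_div, abs_pow, Nat.abs_cast]
  gcongr
  exact ha k

lemma hasDerivAt_tsum_mul_pow_div_factorial (ha : ∀ k, |a k| ≤ C) (s : ℝ) :
    HasDerivAt (fun s => ∑' k, a k * (s ^ k / (k.factorial : ℝ)))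
      (∑' k, a (k + 1) * (s ^ k / (k.factorial : ℝ))) s := by
  have hC : 0 ≤ C := (abs_nonneg _).trans (ha 0)
  -- Termwise differentiation needs a summable bound near `s`, here on the ball of radius `R` about
  -- 0.
  set R : ℝ := |s| + 1
  have hR : 0 ≤ R := by positivity
  let g' : ℕ → ℝ → ℝ := fun k y => a k * ((k : ℝ) * y ^ (k - 1) / (k.factorial : ℝ))
  let u : ℕ → ℝ := fun k => C * ((k : ℝ) * R ^ (k - 1) / (k.factorial : ℝ))
  have hshift : ∀ (y : ℝ) (k : ℕ), ((k + 1 : ℕ) : ℝ) * y ^ (k + 1 - 1) / ((k + 1).factorial : ℝ)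
      = y ^ k / (k.factorial : ℝ) := by
    intro y k
    rw [Nat.factorial_succ, Nat.add_sub_cancel]
    push_cast
    have := Nat.factorial_ne_zero k
    field_simp
  have hu : Summable u := by
    rw [← summable_nat_add_iff 1]
    refine ((Real.summable_pow_div_factorial R).mul_left C).congr fun k => ?_
    simp only [u]
    rw [hshift]
  have key := hasDerivAt_tsum_of_isPreconnected (g := fun k y => a k * (y ^ k / (k.factorial : ℝ)))
    (g' := g') (t := Metric.ball (0 : ℝ) R) (y₀ := s) (y := s) hu Metric.isOpen_ball
    (convex_ball _ _).isPreconnected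
    (fun k y _ => by
      simpa [g'] using ((hasDerivAt_pow k y).div_const (k.factorial : ℝ)).const_mul (a k))
    (fun k y hy => by
      rw [Metric.mem_ball, dist_zero_right, Real.norm_eq_abs] at hy
      simp only [g', u]
      rw [norm_mul, Real.norm_eq_abs, Real.norm_eq_abs, abs_div, abs_mul, abs_pow, Nat.abs_cast,
        Nat.abs_cast]
      gcongr
      exact ha k)
    (by simp [R]) (summable_mul_pow_div_factorial ha s) (by simp [R])
  have hsum : ∑' k, g' k s = ∑' k, a (k + 1) * (s ^ k / (k.factorial : ℝ)) := by
    have hg : Summable fun k => g' k s := by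
      rw [← summable_nat_add_iff 1]
      refine (summable_mul_pow_div_factorial (a := fun k => a (k + 1)) (fun k => ha (k + 1)) s).congr
        fun k => ?_
      simp only [g']
      rw [hshift]
    rw [hg.tsum_eq_zero_add]
    simp only [g', hshift]
    simp
  rwa [hsum] at key

lemma poissonMix_sub (ha : ∀ k, |a k| ≤ C) (hb : ∀ k, |b k| ≤ C) (s : ℝ) :
    poissonMix (fun k => a k - b k) s = poissonMix a s - poissonMix b s := by
  unfold poissonMix
  rw [← mul_sub, ← (summable_mul_pow_div_factorial ha s).tsum_sub
    (summable_mul_pow_div_factorial hb s)]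
  simp_rw [sub_mul]

lemma poissonMix_add (ha : ∀ k, |a k| ≤ C) (hb : ∀ k, |b k| ≤ C) (s : ℝ) :
    poissonMix (fun k => a k + b k) s = poissonMix a s + poissonMix b s := by
  unfold poissonMix
  rw [← mul_add, ← (summable_mul_pow_div_factorial ha s).tsum_add
    (summable_mul_pow_div_factorial hb s)]
  simp_rw [add_mul]

lemma poissonMix_const_mul (x s : ℝ) :
    poissonMix (fun k => x * a k) s = x * poissonMix a s := by
  unfold poissonMix
  simp_rw [mul_assoc]
  rw [tsum_mul_left]
  ring

/-- Differentiation in the mean becomes a forward difference of the sequence; this turns the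
one-step recursion of a chain into the Kolmogorov equation. -/
lemma hasDerivAt_poissonMix (ha : ∀ k, |a k| ≤ C) (s : ℝ) :
    HasDerivAt (poissonMix a) (poissonMix (fun k => a (k + 1) - a k) s) s := by
  rw [poissonMix_sub (fun k => ha (k + 1)) ha]
  have h1 : HasDerivAt (fun s : ℝ => Real.exp (-s)) (-Real.exp (-s)) s := by
    simpa using (hasDerivAt_neg s).exp
  refine (h1.mul (hasDerivAt_tsum_mul_pow_div_factorial ha s)).congr_deriv ?_
  unfold poissonMix
  ring

lemma tsum_poisson (s : ℝ) : Real.exp (-s) * ∑' k : ℕ, s ^ k / (k.factorial : ℝ) = 1 := by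
  have := NormedSpace.expSeries_div_hasSum_exp (𝔸 := ℝ) s
  rw [this.tsum_eq, ← Real.exp_eq_exp_ℝ, ← Real.exp_add]
  simp

lemma poissonMix_nonneg (ha : ∀ k, 0 ≤ a k) {s : ℝ} (hs : 0 ≤ s) : 0 ≤ poissonMix a s :=
  mul_nonneg (Real.exp_pos _).le (tsum_nonneg fun k => mul_nonneg (ha k) (by positivity))

lemma poissonMix_le {x : ℝ} (ha0 : ∀ k, 0 ≤ a k) (ha : ∀ k, a k ≤ x) {s : ℝ} (hs : 0 ≤ s) :
    poissonMix a s ≤ x := by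
  have hx : ∀ k, |a k| ≤ x := fun k => by rw [abs_of_nonneg (ha0 k)]; exact ha k
  calc poissonMix a s ≤ Real.exp (-s) * ∑' k : ℕ, x * (s ^ k / (k.factorial : ℝ)) := by
        unfold poissonMix
        gcongr
        · exact summable_mul_pow_div_factorial hx s
        · exact (Real.summable_pow_div_factorial s).mul_left x
        · exact ha _
    _ = x := by
        rw [tsum_mul_left, mul_left_comm, tsum_poisson, mul_one]

lemma poissonMix_zero : poissonMix a 0 = a 0 := by
  unfold poissonMix
  rw [tsum_eq_single 0]
  · simp
  · intro k hk
    simp [hk]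

lemma hasSum_tsum_mul {v : ℕ → ℕ → ℝ} {w : ℕ → ℝ} (hv0 : ∀ k n, 0 ≤ v k n)
    (hv : ∀ k, HasSum (v k) 1) (hw0 : ∀ k, 0 ≤ w k) (hw : Summable w) :
    HasSum (fun n => ∑' k, v k n * w k) (∑' k, w k) := by
  have hrow : ∀ k, HasSum (fun n => v k n * w k) (w k) := fun k => by
    simpa using (hv k).mul_right (w k)
  have hS : Summable (Function.uncurry fun k n => v k n * w k) :=
    (summable_prod_of_nonneg (f := Function.uncurry fun k n => v k n * w k)
      fun x => mul_nonneg (hv0 x.1 x.2) (hw0 x.1)).2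
      ⟨fun k => (hrow k).summable, hw.congr fun k => (hrow k).tsum_eq.symm⟩
  have h2 : ∑' n, ∑' k, v k n * w k = ∑' k, w k := by
    rw [hS.tsum_comm]
    exact tsum_congr fun k => (hrow k).tsum_eq
  rw [← h2]
  exact hS.prod_symm.prod.hasSum

lemma hasSum_poissonMix_one {v : ℕ → ℕ → ℝ} (hv0 : ∀ k n, 0 ≤ v k n) (hv : ∀ k, HasSum (v k) 1)
    {s : ℝ} (hs : 0 ≤ s) : HasSum (fun n => poissonMix (fun k => v k n) s) 1 := by
  rw [← tsum_poisson s]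
  exact (hasSum_tsum_mul hv0 hv (fun k => by positivity)
    (Real.summable_pow_div_factorial s)).mul_left _

end PoissonMix

/-! ### Uniformization: construction of the transition probabilities -/

namespace GroupServerQueue

variable {K : ℕ} (Q : GroupServerQueue K)

/-- The total service rate of all servers. -/
def maxRate : ℝ := ∑ k, (Q.servers k : ℝ) * Q.rate k

/-- A uniformization constant: an upper bound for the total transition rate of any state. -/
def uniformRate : ℝ := Q.arrival + Q.maxRate

variable {Q} {d : ℕ → Fin K → ℕ}

lemma serviceRate_nonneg (m : Fin K → ℕ) : 0 ≤ Q.serviceRate m :=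
  Finset.sum_nonneg fun k _ => mul_nonneg (Nat.cast_nonneg _) (Q.rate_pos k).le

lemma maxRate_nonneg : 0 ≤ Q.maxRate := serviceRate_nonneg (Q := Q) Q.servers

lemma uniformRate_pos : 0 < Q.uniformRate := add_pos_of_pos_of_nonneg Q.arrival_pos maxRate_nonneg

lemma serviceRate_le_maxRate {m : Fin K → ℕ} (hm : ∀ k, m k ≤ Q.servers k) :
    Q.serviceRate m ≤ Q.maxRate :=
  Finset.sum_le_sum fun k _ =>
    mul_le_mul_of_nonneg_right (Nat.cast_le.2 (hm k)) (Q.rate_pos k).le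

lemma serviceRate_eq_zero_iff {m : Fin K → ℕ} : Q.serviceRate m = 0 ↔ m = 0 := by
  unfold serviceRate
  rw [Finset.sum_eq_zero_iff_of_nonneg
    fun k _ => mul_nonneg (Nat.cast_nonneg _) (Q.rate_pos k).le]
  simp [(Q.rate_pos _).ne', funext_iff]

lemma serviceRate_zero : Q.serviceRate (0 : Fin K → ℕ) = 0 := serviceRate_eq_zero_iff.2 rfl

lemma IsEfficient.zero (hd : Q.IsEfficient d) : d 0 = 0 := by
  have := (hd 0).2
  simpa [funext_iff] using this

variable (Q d) in
/-- One step of the uniformized chain, acting on row vectors. -/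
noncomputable def uniformStep (v : ℕ → ℝ) (n : ℕ) : ℝ := v n + Q.forward d v n / Q.uniformRate

/-- `uniformRate` bounds the total exit rate of every state, so the diagonal of the one-step matrix
stays nonnegative. -/
lemma uniformStep_nonneg (hd : Q.IsEfficient d) {v : ℕ → ℝ} (hv : ∀ n, 0 ≤ v n) (n : ℕ) :
    0 ≤ Q.uniformStep d v n := by
  have hU := Q.uniformRate_pos
  have key : 0 ≤ Q.uniformRate * v n + Q.forward d v n := by
    cases n with
    | zero =>
      have h1 := mul_nonneg (maxRate_nonneg (Q := Q)) (hv 0)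
      have h2 := mul_nonneg (serviceRate_nonneg (Q := Q) (d 1)) (hv 1)
      simp only [forward, uniformRate]
      nlinarith
    | succ n =>
      have h1 := mul_le_mul_of_nonneg_right (serviceRate_le_maxRate (hd (n + 1)).1) (hv (n + 1))
      have h2 := mul_nonneg (serviceRate_nonneg (Q := Q) (d (n + 2))) (hv (n + 2))
      have h3 := mul_nonneg Q.arrival_pos.le (hv n)
      simp only [forward, uniformRate]
      nlinarith
  have : Q.uniformStep d v n = (Q.uniformRate * v n + Q.forward d v n) / Q.uniformRate := by
    unfold uniformStep
    field_simp
  rw [this]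
  exact div_nonneg key hU.le

/-- The sum telescopes to the net flux across the cut between `N` and `N + 1`. -/
lemma sum_forward (v : ℕ → ℝ) (N : ℕ) :
    ∑ n ∈ Finset.range (N + 1), Q.forward d v n
      = Q.serviceRate (d (N + 1)) * v (N + 1) - Q.arrival * v N := by
  induction N with
  | zero => simp [forward]; ring
  | succ N ih => rw [Finset.sum_range_succ, ih, forward]; ring

lemma summable_serviceRate_mul (hd : Q.IsEfficient d) {v : ℕ → ℝ} (hv : Summable v)
    (hv0 : ∀ n, 0 ≤ v n) : Summable fun n => Q.serviceRate (d n) * v n :=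
  Summable.of_nonneg_of_le (fun n => mul_nonneg (serviceRate_nonneg _) (hv0 n))
    (fun n => mul_le_mul_of_nonneg_right (serviceRate_le_maxRate (hd n).1) (hv0 n))
    (hv.mul_left Q.maxRate)

lemma hasSum_forward (hd : Q.IsEfficient d) {v : ℕ → ℝ} (hv : Summable v) (hv0 : ∀ n, 0 ≤ v n) :
    HasSum (Q.forward d v) 0 := by
  have hs := summable_serviceRate_mul hd hv hv0
  have hsum : Summable (Q.forward d v) := by
    rw [← summable_nat_add_iff 1]
    have h1 := (hv.mul_left Q.arrival)
    have h2 := (summable_nat_add_iff 1).2 h1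
    have h3 := (summable_nat_add_iff 1).2 hs
    have h4 := (summable_nat_add_iff 2).2 hs
    refine ((h1.sub (h2.add h3)).add h4).congr fun n => ?_
    simp only [forward]
    ring
  have ht : Filter.Tendsto (fun N => ∑ n ∈ Finset.range (N + 1), Q.forward d v n) Filter.atTop
      (nhds 0) := by
    simp_rw [sum_forward]
    have h1 := ((summable_nat_add_iff 1).2 hs).tendsto_atTop_zero
    have h2 := (hv.mul_left Q.arrival).tendsto_atTop_zero
    simpa using h1.sub h2
  have h' := (Filter.tendsto_add_atTop_iff_nat 1).2 hsum.hasSum.tendsto_sum_nat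
  rw [← tendsto_nhds_unique h' ht]
  exact hsum.hasSum

lemma hasSum_uniformStep (hd : Q.IsEfficient d) {v : ℕ → ℝ} (hv : HasSum v 1)
    (hv0 : ∀ n, 0 ≤ v n) : HasSum (Q.uniformStep d v) 1 := by
  have := hv.add ((hasSum_forward hd hv.summable hv0).div_const Q.uniformRate)
  rw [zero_div, add_zero] at this
  exact this

variable (Q d) in
/-- The distribution of the uniformized chain after `k` steps, started in state `i`. -/
noncomputable def uniformChain (i : ℕ) : ℕ → ℕ → ℝ
  | 0 => fun n => if n = i then 1 else 0
  | k + 1 => Q.uniformStep d (uniformChain i k)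

lemma uniformChain_nonneg (hd : Q.IsEfficient d) (i k n : ℕ) : 0 ≤ Q.uniformChain d i k n := by
  induction k generalizing n with
  | zero => simp only [uniformChain]; split_ifs <;> norm_num
  | succ k ih => exact uniformStep_nonneg hd ih n

lemma hasSum_uniformChain (hd : Q.IsEfficient d) (i k : ℕ) : HasSum (Q.uniformChain d i k) 1 := by
  induction k with
  | zero => exact hasSum_ite_eq i 1
  | succ k ih => exact hasSum_uniformStep hd ih (uniformChain_nonneg hd i k)

lemma uniformChain_le_one (hd : Q.IsEfficient d) (i k n : ℕ) : Q.uniformChain d i k n ≤ 1 :=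
  le_hasSum (hasSum_uniformChain hd i k) n fun m _ => uniformChain_nonneg hd i k m

lemma abs_uniformChain_le (hd : Q.IsEfficient d) (i n k : ℕ) : |Q.uniformChain d i k n| ≤ 1 := by
  rw [abs_of_nonneg (uniformChain_nonneg hd i k n)]
  exact uniformChain_le_one hd i k n

variable (Q d) in
/-- The transition probabilities of the number of customers, by uniformization. -/
noncomputable def transition (i : ℕ) (t : ℝ) (n : ℕ) : ℝ :=
  poissonMix (fun k => Q.uniformChain d i k n) (Q.uniformRate * t)

lemma poissonMix_forward {v : ℕ → ℕ → ℝ} (hv : ∀ n k, |v k n| ≤ 1) (s : ℝ) (n : ℕ) :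
    poissonMix (fun k => Q.forward d (v k) n) s
      = Q.forward d (fun n => poissonMix (fun k => v k n) s) n := by
  have hb : ∀ (x : ℝ) (n k : ℕ), |x * v k n| ≤ |x| := fun x n k => by
    rw [abs_mul]
    exact mul_le_of_le_one_right (abs_nonneg _) (hv n k)
  cases n with
  | zero =>
    simp only [forward]
    have h1 := fun k => (hb (-Q.arrival) 0 k).trans
      (le_max_left _ |Q.serviceRate (d 1)|)
    have h2 := fun k => (hb (Q.serviceRate (d 1)) 1 k).trans
      (le_max_right |-Q.arrival| _)
    rw [poissonMix_add h1 h2, poissonMix_const_mul, poissonMix_const_mul]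
  | succ n =>
    simp only [forward]
    set x := Q.arrival
    set y := Q.arrival + Q.serviceRate (d (n + 1))
    set z := Q.serviceRate (d (n + 2))
    have h1 : ∀ k, |x * v k n| ≤ |x| + |y| + |z| := fun k => (hb x n k).trans (by
      linarith [abs_nonneg y, abs_nonneg z])
    have h2 : ∀ k, |y * v k (n + 1)| ≤ |x| + |y| + |z| := fun k => (hb y (n + 1) k).trans (by
      linarith [abs_nonneg x, abs_nonneg z])
    have h3 : ∀ k, |z * v k (n + 2)| ≤ (|x| + |y| + |z|) + (|x| + |y| + |z|) := fun k =>
      (hb z (n + 2) k).trans (by linarith [abs_nonneg x, abs_nonneg y, abs_nonneg z])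
    have h4 : ∀ k, |x * v k n - y * v k (n + 1)| ≤ (|x| + |y| + |z|) + (|x| + |y| + |z|) :=
      fun k => (abs_sub _ _).trans (add_le_add (h1 k) (h2 k))
    rw [poissonMix_add h4 h3, poissonMix_sub h1 h2, poissonMix_const_mul, poissonMix_const_mul,
      poissonMix_const_mul]

/-- The uniformized chain makes a Poisson number of steps, of mean `uniformRate * t`, up to time
`t`. -/
lemma isLaw_transition (hd : Q.IsEfficient d) (i : ℕ) : Q.IsLaw d i (Q.transition d i) where
  nonneg t ht n := poissonMix_nonneg (fun k => uniformChain_nonneg hd i k n)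
    (mul_nonneg uniformRate_pos.le ht)
  hasSum_one t ht := hasSum_poissonMix_one (uniformChain_nonneg hd i) (hasSum_uniformChain hd i)
    (mul_nonneg uniformRate_pos.le ht)
  initial n := by simp [transition, poissonMix_zero, uniformChain]
  kolmogorov t _ n := by
    refine HasDerivAt.hasDerivWithinAt ?_
    have h1 := (hasDerivAt_poissonMix (abs_uniformChain_le hd i n) (Q.uniformRate * t)).comp t
      ((hasDerivAt_id t).const_mul Q.uniformRate)
    refine h1.congr_deriv ?_
    have h2 : (fun k => Q.uniformChain d i (k + 1) n - Q.uniformChain d i k n)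
        = fun k => Q.uniformRate⁻¹ * Q.forward d (Q.uniformChain d i k) n := by
      funext k
      simp only [uniformChain, uniformStep]
      ring
    rw [h2, poissonMix_const_mul, poissonMix_forward (abs_uniformChain_le hd i)]
    have := (uniformRate_pos (Q := Q)).ne'
    change _ = Q.forward d
      (fun n => poissonMix (fun k => Q.uniformChain d i k n) (Q.uniformRate * t)) n
    field_simp

end GroupServerQueue

/-! ### Stationary distributions and domination of the transition probabilities -/

open Filter Topology

namespace GroupServerQueue

variable {K : ℕ} (Q : GroupServerQueue K)

/-- `w` is a stationary distribution of the number of customers under the policy `d`, in the form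
of the detailed balance equations of a birth-death chain. -/
structure IsStationary (d : ℕ → Fin K → ℕ) (w : ℕ → ℝ) : Prop where
  nonneg : ∀ n, 0 ≤ w n
  hasSum_one : HasSum w 1
  balance : ∀ n, Q.serviceRate (d (n + 1)) * w (n + 1) = Q.arrival * w n

/-- The fraction of the time up to `T` that is spent in state `n`. -/
noncomputable def timeAverage (p : ℝ → ℕ → ℝ) (T : ℝ) (n : ℕ) : ℝ :=
  T⁻¹ * ∫ t in (0 : ℝ)..T, p t n

variable {Q} {d : ℕ → Fin K → ℕ} {w x y : ℕ → ℝ}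

namespace IsStationary

lemma pos_succ (hw : Q.IsStationary d w) {n : ℕ} (h : 0 < w n) : 0 < w (n + 1) := by
  have h1 : 0 < Q.serviceRate (d (n + 1)) * w (n + 1) := by
    rw [hw.balance]; exact mul_pos Q.arrival_pos h
  exact pos_of_mul_pos_right h1 (serviceRate_nonneg _)

lemma pos_of_le (hw : Q.IsStationary d w) {m n : ℕ} (hmn : m ≤ n) (h : 0 < w m) : 0 < w n := by
  induction n, hmn using Nat.le_induction with
  | base => exact h
  | succ n _ ih => exact hw.pos_succ ih

lemma exists_pos (hw : Q.IsStationary d w) : ∃ n, 0 < w n := by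
  by_contra! h
  have h0 : w = fun _ => 0 := funext fun n => le_antisymm (h n) (hw.nonneg n)
  have h1 := hw.hasSum_one
  rw [h0] at h1
  exact zero_ne_one (hasSum_zero.unique h1)

/-- The positive recurrent states of a birth-death chain are those from some state on. -/
lemma exists_first_pos (hw : Q.IsStationary d w) :
    ∃ b, (∀ n, n < b → w n = 0) ∧ ∀ n, b ≤ n → 0 < w n := by
  classical
  refine ⟨Nat.find hw.exists_pos, fun n hn => ?_, fun n hn =>
    hw.pos_of_le hn (Nat.find_spec hw.exists_pos)⟩
  exact le_antisymm (not_lt.1 (Nat.find_min hw.exists_pos hn)) (hw.nonneg n)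

/-- No mass lies just below `b`, so the balance across that cut forces the service rate in `b` to
vanish. -/
lemma policy_first_pos_eq_zero (hd : Q.IsEfficient d) (hw : Q.IsStationary d w) {b : ℕ}
    (hb0 : ∀ n, n < b → w n = 0) (hb : 0 < w b) : d b = 0 := by
  cases b with
  | zero => exact hd.zero
  | succ b =>
    have := hw.balance b
    rw [hb0 b b.lt_succ_self, mul_zero, mul_eq_zero, or_iff_left hb.ne'] at this
    exact serviceRate_eq_zero_iff.1 this

/-- By balance, a strict inequality between two solutions propagates to all higher states. So if it
holds in one state, the reverse strict inequality holds nowhere, and the total masses cannot both be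
1. -/
lemma le_of_balance (hx : Q.IsStationary d x) (hy : Q.IsStationary d y) (n : ℕ) : x n ≤ y n := by
  by_contra! h
  have hstep : ∀ {u v : ℕ → ℝ}, Q.IsStationary d u → Q.IsStationary d v →
      ∀ {m k : ℕ}, m ≤ k → v m < u m → v k < u k := by
    intro u v hu hv m k hmk hm
    induction k, hmk using Nat.le_induction with
    | base => exact hm
    | succ k _ ih =>
      by_contra! hle
      have := mul_le_mul_of_nonneg_left hle (serviceRate_nonneg (Q := Q) (d (k + 1)))
      rw [hu.balance, hv.balance] at this
      exact absurd ih (not_lt.2 (le_of_mul_le_mul_left this Q.arrival_pos))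
  have hle : ∀ m, y m ≤ x m := fun m => by
    rcases le_total n m with hnm | hmn
    · exact (hstep hx hy hnm h).le
    · by_contra! hlt
      exact absurd (hstep hy hx hmn hlt) (not_lt.2 h.le)
  have := hasSum_lt hle h hy.hasSum_one hx.hasSum_one
  exact lt_irrefl _ this

lemma unique (hx : Q.IsStationary d x) (hy : Q.IsStationary d y) : x = y :=
  funext fun n => le_antisymm (le_of_balance hx hy n) (le_of_balance hy hx n)

end IsStationary

lemma uniformRate_mul_uniformStep (v : ℕ → ℝ) (n : ℕ) :
    Q.uniformRate * Q.uniformStep d v n = Q.uniformRate * v n + Q.forward d v n := by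
  have := (uniformRate_pos (Q := Q)).ne'
  unfold uniformStep
  field_simp

/-- On the recurrent states, the distributions of the uniformized chain are dominated by a multiple
of the stationary distribution. -/
lemma exists_uniformChain_le (hd : Q.IsEfficient d) (hw : Q.IsStationary d w) (i : ℕ) :
    ∃ C b, ∀ k n, b ≤ n → Q.uniformChain d i k n ≤ C * w n := by
  obtain ⟨b, hb0, hb⟩ := hw.exists_first_pos
  have hwb := hb b le_rfl
  have hwm := hb (max i b) (le_max_right _ _)
  have hdb := hw.policy_first_pos_eq_zero hd hb0 hwb
  -- The first summand controls mass that enters at `b` from below, the second the initial unit mass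
  -- if `i` is recurrent.
  set C : ℝ := 1 / w b + 1 / w (max i b)
  have hC0 : 0 ≤ C := by positivity
  have hCb : 1 ≤ C * w b := by
    have : 1 / w b * w b = 1 := by field_simp
    have h2 : 0 ≤ 1 / w (max i b) * w b := by positivity
    simp only [C, add_mul]
    linarith
  have hCm : 1 ≤ C * w (max i b) := by
    have : 1 / w (max i b) * w (max i b) = 1 := by field_simp
    have h2 : 0 ≤ 1 / w b * w (max i b) := by positivity
    simp only [C, add_mul]
    linarith
  -- The mass in the states from `b` on. It never decreases, since there is no service in `b`.
  let S : ℕ → ℝ := fun k => 1 - ∑ j ∈ Finset.range b, Q.uniformChain d i k j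
  have hS0 : ∀ k, 0 ≤ S k := fun k => sub_nonneg.2
    (sum_le_hasSum _ (fun j _ => uniformChain_nonneg hd i k j) (hasSum_uniformChain hd i k))
  have hS1 : ∀ k, S k ≤ 1 := fun k => sub_le_self _
    (Finset.sum_nonneg fun j _ => uniformChain_nonneg hd i k j)
  have hU := uniformRate_pos (Q := Q)
  have hSsucc : ∀ k, Q.uniformRate * S (k + 1)
      = Q.uniformRate * S k - ∑ j ∈ Finset.range b, Q.forward d (Q.uniformChain d i k) j := by
    intro k
    simp only [S, uniformChain, mul_sub, Finset.mul_sum, uniformRate_mul_uniformStep,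
      Finset.sum_add_distrib]
    ring
  have hflow : ∀ k, (∑ j ∈ Finset.range b, Q.forward d (Q.uniformChain d i k) j) ≤ 0 ∧
      Q.forward d (Q.uniformChain d i k) b
        = -(∑ j ∈ Finset.range b, Q.forward d (Q.uniformChain d i k) j)
          - Q.arrival * Q.uniformChain d i k b
          + Q.serviceRate (d (b + 1)) * Q.uniformChain d i k (b + 1) := by
    intro k
    have hsb : Q.serviceRate (d b) = 0 := by rw [hdb, serviceRate_zero]
    constructor
    · cases b with
      | zero => simp
      | succ m =>
        rw [sum_forward, hsb]
        have := mul_nonneg Q.arrival_pos.le (uniformChain_nonneg hd i k m)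
        linarith
    · have := sum_forward (Q := Q) (d := d) (Q.uniformChain d i k) b
      rw [Finset.sum_range_succ] at this
      linarith
  -- The factor `S k` strengthens the induction: its growth pays for the inflow into `b` from the
  -- transient states.
  have main : ∀ k n, b ≤ n → Q.uniformChain d i k n ≤ C * S k * w n := by
    intro k
    induction k with
    | zero =>
      intro n hn
      simp only [uniformChain]
      split_ifs with h
      · subst h
        have : S 0 = 1 := by
          simp only [S, uniformChain]
          rw [Finset.sum_ite_eq', if_neg (by simpa using hn), sub_zero]
        rw [max_eq_left hn] at hCm
        rw [this, mul_one]
        exact hCm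
      · exact mul_nonneg (mul_nonneg hC0 (hS0 0)) (hw.nonneg n)
    | succ k ih =>
      intro n hn
      refine le_of_mul_le_mul_left ?_ hU
      have hSk : Q.uniformRate * S k ≤ Q.uniformRate * S (k + 1) := by
        rw [hSsucc]; linarith [(hflow k).1]
      rw [uniformChain, uniformRate_mul_uniformStep]
      have h1 := mul_le_mul_of_nonneg_left (ih (n + 1) (by omega))
        (serviceRate_nonneg (Q := Q) (d (n + 1)))
      have h1' : Q.serviceRate (d (n + 1)) * (C * S k * w (n + 1))
          = C * S k * (Q.arrival * w n) := by rw [← hw.balance]; ring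
      rw [h1'] at h1
      rcases hn.eq_or_lt with rfl | hlt
      · rw [(hflow k).2]
        set F := ∑ j ∈ Finset.range b, Q.forward d (Q.uniformChain d i k) j
        have h2 := mul_le_mul_of_nonneg_left (ih b le_rfl) (maxRate_nonneg (Q := Q))
        have h3 : Q.uniformRate * (C * S (k + 1) * w b)
            = Q.uniformRate * (C * S k * w b) - F * (C * w b) := by
          linear_combination (C * w b) * hSsucc k
        have h4 : -F ≤ -F * (C * w b) :=
          le_mul_of_one_le_right (neg_nonneg.2 (hflow k).1) hCb
        rw [h3]
        simp only [uniformRate]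
        linarith
      · obtain ⟨m, rfl⟩ : ∃ m, n = m + 1 := ⟨n - 1, by omega⟩
        have h2 := mul_le_mul_of_nonneg_left (ih m (by omega)) Q.arrival_pos.le
        have h3 := mul_le_mul_of_nonneg_left (ih (m + 1) hn)
          (sub_nonneg.2 (serviceRate_le_maxRate (hd (m + 1)).1))
        have h4 : Q.arrival * (C * S k * w m)
            = C * S k * (Q.serviceRate (d (m + 1)) * w (m + 1)) := by rw [hw.balance]; ring
        have h5 := mul_le_mul_of_nonneg_right hSk (mul_nonneg hC0 (hw.nonneg (m + 1)))
        simp only [forward]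
        simp only [uniformRate] at h5 ⊢
        linarith
  refine ⟨C, b, fun k n hn => (main k n hn).trans ?_⟩
  exact mul_le_mul_of_nonneg_right (mul_le_of_le_one_right hC0 (hS1 k)) (hw.nonneg n)

/-- Provides a majorant uniform in time for dominated convergence. The finitely many states below
`b` can be bounded by 1 without affecting summability. -/
lemma exists_transition_le (hd : Q.IsEfficient d) (hw : Q.IsStationary d w) (i : ℕ) :
    ∃ W : ℕ → ℝ, (∀ t, 0 ≤ t → ∀ n, Q.transition d i t n ≤ W n) ∧
      ∀ g : ℕ → ℝ, Summable (fun n => w n * g n) → Summable fun n => W n * |g n| := by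
  obtain ⟨C, b, hC⟩ := exists_uniformChain_le hd hw i
  refine ⟨fun n => if b ≤ n then C * w n else 1, fun t ht n => ?_, fun g hg => ?_⟩
  · refine poissonMix_le (fun k => uniformChain_nonneg hd i k n) (fun k => ?_)
      (mul_nonneg uniformRate_pos.le ht)
    dsimp only
    split_ifs with h
    · exact hC k n h
    · exact uniformChain_le_one hd i k n
  · have h1 := (summable_nat_add_iff b).2 (hg.abs.mul_left C)
    refine (summable_nat_add_iff b).1 (h1.congr fun n => ?_)
    simp only [if_pos (Nat.le_add_left b n)]
    rw [abs_mul, abs_of_nonneg (hw.nonneg _), mul_assoc]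

/-! ### Time averages and the long-run average cost -/

section IsLaw

variable {p : ℝ → ℕ → ℝ} {i : ℕ}

namespace IsLaw

lemma continuousOn (hp : Q.IsLaw d i p) (n : ℕ) : ContinuousOn (fun t => p t n) (Set.Ici 0) :=
  fun t ht => (hp.kolmogorov t ht n).continuousWithinAt

lemma le_one (hp : Q.IsLaw d i p) {t : ℝ} (ht : 0 ≤ t) (n : ℕ) : p t n ≤ 1 :=
  le_hasSum (hp.hasSum_one t ht) n fun m _ => hp.nonneg t ht m

lemma uIcc_subset {T : ℝ} (hT : 0 ≤ T) : Set.uIcc 0 T ⊆ Set.Ici 0 := by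
  rw [Set.uIcc_of_le hT]
  exact fun t ht => ht.1

lemma intervalIntegrable (hp : Q.IsLaw d i p) {T : ℝ} (hT : 0 ≤ T) (n : ℕ) :
    IntervalIntegrable (fun t => p t n) MeasureTheory.volume 0 T :=
  ((hp.continuousOn n).mono (uIcc_subset hT)).intervalIntegrable

lemma intervalIntegrable_sum_mul (hp : Q.IsLaw d i p) {T : ℝ} (hT : 0 ≤ T) (s : Finset ℕ)
    (g : ℕ → ℝ) :
    IntervalIntegrable (fun t => ∑ n ∈ s, p t n * g n) MeasureTheory.volume 0 T :=
  (continuousOn_finsetSum s fun n _ =>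
    ((hp.continuousOn n).mono (uIcc_subset hT)).mul continuousOn_const).intervalIntegrable

lemma timeAverage_nonneg (hp : Q.IsLaw d i p) {T : ℝ} (hT : 0 ≤ T) (n : ℕ) :
    0 ≤ timeAverage p T n :=
  mul_nonneg (inv_nonneg.2 hT)
    (intervalIntegral.integral_nonneg hT fun t ht => hp.nonneg t ht.1 n)

lemma timeAverage_le (hp : Q.IsLaw d i p) {T : ℝ} (hT : 0 < T) {n : ℕ} {c : ℝ}
    (hc : ∀ t, 0 ≤ t → p t n ≤ c) : timeAverage p T n ≤ c := by
  have h1 : ∫ t in (0 : ℝ)..T, p t n ≤ ∫ _ in (0 : ℝ)..T, c :=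
    intervalIntegral.integral_mono_on hT.le (hp.intervalIntegrable hT.le n)
      intervalIntegrable_const fun t ht => hc t ht.1
  rw [intervalIntegral.integral_const, sub_zero, smul_eq_mul] at h1
  unfold timeAverage
  rw [inv_mul_le_iff₀ hT]
  exact h1

/-- The flux across the cut is the derivative of the probability of at most `n` customers, so its
integral over time has absolute value at most 1. -/
lemma abs_flux_le (hp : Q.IsLaw d i p) {T : ℝ} (hT : 0 < T) (n : ℕ) :
    |Q.serviceRate (d (n + 1)) * timeAverage p T (n + 1) - Q.arrival * timeAverage p T n|
      ≤ T⁻¹ := by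
  let P : ℝ → ℝ := fun t => ∑ j ∈ Finset.range (n + 1), p t j
  let P' : ℝ → ℝ := fun t => Q.serviceRate (d (n + 1)) * p t (n + 1) - Q.arrival * p t n
  have hP : ∀ t, 0 ≤ t → HasDerivWithinAt P (P' t) (Set.Ici 0) t := fun t ht => by
    have := HasDerivWithinAt.fun_sum (u := Finset.range (n + 1)) fun j _ => hp.kolmogorov t ht j
    rwa [sum_forward] at this
  have hPc : ContinuousOn P (Set.Ici 0) := fun t ht => (hP t ht).continuousWithinAt
  have hi := (hp.intervalIntegrable hT.le (n + 1)).const_mul (Q.serviceRate (d (n + 1)))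
  have hi' := (hp.intervalIntegrable hT.le n).const_mul Q.arrival
  have hint : ∫ t in (0 : ℝ)..T, P' t = P T - P 0 := by
    refine intervalIntegral.integral_eq_sub_of_hasDeriv_right (hPc.mono (uIcc_subset hT.le))
      (fun t ht => ?_) (hi.sub hi')
    rw [min_eq_left hT.le, max_eq_right hT.le] at ht
    exact (hP t ht.1.le).mono fun s hs => ht.1.le.trans (le_of_lt hs)
  have hsplit : ∫ t in (0 : ℝ)..T, P' t = Q.serviceRate (d (n + 1)) * (∫ t in (0 : ℝ)..T, p t (n + 1))
      - Q.arrival * ∫ t in (0 : ℝ)..T, p t n := by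
    rw [intervalIntegral.integral_sub hi hi', intervalIntegral.integral_const_mul,
      intervalIntegral.integral_const_mul]
  have hP01 : ∀ t, 0 ≤ t → 0 ≤ P t ∧ P t ≤ 1 := fun t ht =>
    ⟨Finset.sum_nonneg fun j _ => hp.nonneg t ht j,
      sum_le_hasSum _ (fun j _ => hp.nonneg t ht j) (hp.hasSum_one t ht)⟩
  have heq : Q.serviceRate (d (n + 1)) * timeAverage p T (n + 1) - Q.arrival * timeAverage p T n
      = T⁻¹ * (P T - P 0) := by
    rw [← hint, hsplit]
    unfold timeAverage
    ring
  rw [heq, abs_mul, abs_of_pos (inv_pos.2 hT)]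
  refine mul_le_of_le_one_right (inv_nonneg.2 hT.le) ?_
  rw [abs_le]
  constructor <;> linarith [(hP01 T hT.le).1, (hP01 T hT.le).2, (hP01 0 le_rfl).1, (hP01 0 le_rfl).2]

/-- Every limit point of the time averages satisfies the balance equations. -/
lemma exists_limit (hp : Q.IsLaw d i p) (U : Ultrafilter ℝ) (hU : (U : Filter ℝ) ≤ atTop) :
    ∃ w : ℕ → ℝ, (∀ n, Tendsto (fun T => timeAverage p T n) U (𝓝 (w n))) ∧ (∀ n, 0 ≤ w n) ∧
      ∀ n, Q.serviceRate (d (n + 1)) * w (n + 1) = Q.arrival * w n := by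
  have hpos : ∀ᶠ T in (U : Filter ℝ), 0 < T := hU (eventually_gt_atTop 0)
  have hlim : ∀ n, ∃ x ∈ Set.Icc (0 : ℝ) 1, Tendsto (fun T => timeAverage p T n) U (𝓝 x) := by
    intro n
    -- Along an ultrafilter all coordinates converge at once, by compactness of the unit interval.
    refine isCompact_Icc.ultrafilter_le_nhds (U.map fun T => timeAverage p T n) ?_
    rw [Ultrafilter.coe_map, le_principal_iff, mem_map]
    filter_upwards [hpos] with T hT
    exact ⟨hp.timeAverage_nonneg hT.le n, hp.timeAverage_le hT fun t ht => hp.le_one ht n⟩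
  choose w hw01 hw using hlim
  refine ⟨w, hw, fun n => (hw01 n).1, fun n => ?_⟩
  have h1 : Tendsto (fun T => Q.serviceRate (d (n + 1)) * timeAverage p T (n + 1)
      - Q.arrival * timeAverage p T n) U
      (𝓝 (Q.serviceRate (d (n + 1)) * w (n + 1) - Q.arrival * w n)) :=
    ((hw (n + 1)).const_mul _).sub ((hw n).const_mul _)
  have h2 : Tendsto (fun T => Q.serviceRate (d (n + 1)) * timeAverage p T (n + 1)
      - Q.arrival * timeAverage p T n) U (𝓝 0) := by
    refine squeeze_zero_norm' ?_ (tendsto_inv_atTop_zero.mono_left hU)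
    filter_upwards [hpos] with T hT using hp.abs_flux_le hT n
  exact sub_eq_zero.1 (tendsto_nhds_unique h1 h2)

lemma summable_of_le (hp : Q.IsLaw d i p) {W g : ℕ → ℝ} (hW : ∀ t, 0 ≤ t → ∀ n, p t n ≤ W n)
    (hg : Summable fun n => W n * |g n|) {t : ℝ} (ht : 0 ≤ t) : Summable fun n => p t n * g n :=
  Summable.of_norm_bounded hg fun n => by
    rw [norm_mul, Real.norm_eq_abs, Real.norm_eq_abs, abs_of_nonneg (hp.nonneg t ht n)]
    exact mul_le_mul_of_nonneg_right (hW t ht n) (abs_nonneg _)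

lemma continuousOn_tsum_mul (hp : Q.IsLaw d i p) {W g : ℕ → ℝ}
    (hW : ∀ t, 0 ≤ t → ∀ n, p t n ≤ W n) (hg : Summable fun n => W n * |g n|) :
    ContinuousOn (fun t => ∑' n, p t n * g n) (Set.Ici 0) := by
  refine continuousOn_tsum (fun n => (hp.continuousOn n).mul continuousOn_const) hg
    fun n t ht => ?_
  rw [norm_mul, Real.norm_eq_abs, Real.norm_eq_abs, abs_of_nonneg (hp.nonneg t ht n)]
  exact mul_le_mul_of_nonneg_right (hW t ht n) (abs_nonneg _)

lemma timeAverage_tsum (hp : Q.IsLaw d i p) {W g : ℕ → ℝ} (hW : ∀ t, 0 ≤ t → ∀ n, p t n ≤ W n)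
    (hg : Summable fun n => W n * |g n|) {T : ℝ} (hT : 0 ≤ T) :
    T⁻¹ * ∫ t in (0 : ℝ)..T, ∑' n, p t n * g n = ∑' n, timeAverage p T n * g n := by
  have hmem : ∀ t ∈ Set.uIoc 0 T, 0 ≤ t := fun t ht => by
    rw [Set.uIoc_of_le hT] at ht; exact ht.1.le
  have h := intervalIntegral.hasSum_integral_of_dominated_convergence (a := 0) (b := T)
    (μ := MeasureTheory.volume) (F := fun n t => p t n * g n) (f := fun t => ∑' n, p t n * g n)
    (fun n _ => W n * |g n|)
    (fun n => ((hp.intervalIntegrable hT n).mul_const (g n)).def'.aestronglyMeasurable)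
    (fun n => Eventually.of_forall fun t ht => by
      rw [norm_mul, Real.norm_eq_abs, Real.norm_eq_abs, abs_of_nonneg (hp.nonneg t (hmem t ht) n)]
      exact mul_le_mul_of_nonneg_right (hW t (hmem t ht) n) (abs_nonneg _))
    (Eventually.of_forall fun t _ => hg) intervalIntegrable_const
    (Eventually.of_forall fun t ht => (hp.summable_of_le hW hg (hmem t ht)).hasSum)
  rw [← (h.mul_left T⁻¹).tsum_eq]
  refine tsum_congr fun n => ?_
  rw [intervalIntegral.integral_mul_const]
  unfold timeAverage
  ring

end IsLaw

end IsLaw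

/-- Ergodic theorem: with a stationary distribution of finite mean cost, the long-run average cost
exists and is the mean cost under the stationary distribution. -/
theorem IsStationary.hasAverageCost (hd : Q.IsEfficient d) (hw : Q.IsStationary d w)
    (hf : Summable fun n => w n * Q.costRate n (d n)) :
    Q.HasAverageCost d (∑' n, w n * Q.costRate n (d n)) := by
  intro i
  obtain ⟨W, hW, hWs⟩ := exists_transition_le hd hw i
  have hp := isLaw_transition hd i
  have hg := hWs _ hf
  -- The case of the constant function 1: the majorant itself is summable, so no mass is lost in the
  -- limit.
  have h1 : Summable fun n => W n * |(1 : ℝ)| := hWs (fun _ => 1) (by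
    simpa using hw.hasSum_one.summable)
  refine ⟨Q.transition d i, hp, fun t ht => hp.summable_of_le hW hg ht, fun T hT =>
    ((hp.continuousOn_tsum_mul hW hg).mono (IsLaw.uIcc_subset hT)).intervalIntegrable, ?_⟩
  -- Along each ultrafilter the limit of the time averages is a stationary distribution, hence `w`
  -- by uniqueness.
  rw [tendsto_iff_ultrafilter]
  intro U hU
  have hpos : ∀ᶠ T in (U : Filter ℝ), 0 < T := hU (eventually_gt_atTop 0)
  obtain ⟨v, hv, hv0, hbal⟩ := hp.exists_limit U hU
  have hconv : ∀ g : ℕ → ℝ, Summable (fun n => W n * |g n|) →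
      Tendsto (fun T : ℝ => T⁻¹ * ∫ t in (0 : ℝ)..T, ∑' n, Q.transition d i t n * g n) U
        (𝓝 (∑' n, v n * g n)) := by
    intro g hg
    have := tendsto_tsum_of_dominated_convergence (𝓕 := (U : Filter ℝ)) hg
      (fun n => (hv n).mul_const (g n)) (by
        filter_upwards [hpos] with T hT n
        rw [norm_mul, Real.norm_eq_abs, Real.norm_eq_abs,
          abs_of_nonneg (hp.timeAverage_nonneg hT.le n)]
        exact mul_le_mul_of_nonneg_right (hp.timeAverage_le hT fun t ht => hW t ht n)
          (abs_nonneg _))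
    refine this.congr' ?_
    filter_upwards [hpos] with T hT
    exact (hp.timeAverage_tsum hW hg hT.le).symm
  have hvW : ∀ n, v n ≤ W n := fun n => le_of_tendsto (hv n) (by
    filter_upwards [hpos] with T hT using hp.timeAverage_le hT fun t ht => hW t ht n)
  have hvs : Summable v := by
    refine Summable.of_nonneg_of_le hv0 hvW ?_
    simpa using h1
  have hv1 : ∑' n, v n = 1 := by
    have h2 := hconv (fun _ => 1) h1
    simp only [mul_one] at h2
    refine tendsto_nhds_unique h2 (tendsto_const_nhds.congr' ?_)
    filter_upwards [hpos] with T hT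
    have : ∫ t in (0 : ℝ)..T, ∑' n, Q.transition d i t n = ∫ _ in (0 : ℝ)..T, (1 : ℝ) := by
      refine intervalIntegral.integral_congr fun t ht => ?_
      exact (hp.hasSum_one t (IsLaw.uIcc_subset hT.le ht)).tsum_eq
    rw [this, intervalIntegral.integral_const, sub_zero, smul_eq_mul, mul_one,
      inv_mul_cancel₀ hT.ne']
  have hvst : Q.IsStationary d v := ⟨hv0, hv1 ▸ hvs.hasSum, hbal⟩
  rw [hw.unique hvst]
  exact hconv _ hg

lemma hold_le_costRate (n : ℕ) (m : Fin K → ℕ) : Q.hold n ≤ Q.costRate n m :=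
  le_add_of_nonneg_right (Finset.sum_nonneg fun k _ =>
    mul_nonneg (Nat.cast_nonneg _) (Q.opCost_nonneg k))

/-- A finite long-run average cost forces a stationary distribution with at most this mean cost. -/
theorem HasAverageCost.exists_isStationary (hh : Q.HoldingCostAssumption) {η : ℝ}
    (h : Q.HasAverageCost d η) :
    ∃ w, Q.IsStationary d w ∧ Summable (fun n => w n * Q.costRate n (d n)) ∧
      ∑' n, w n * Q.costRate n (d n) ≤ η := by
  obtain ⟨p, hp, hsum, hint, hlim⟩ := h 0
  let U : Ultrafilter ℝ := Ultrafilter.of atTop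
  have hU : (U : Filter ℝ) ≤ atTop := Ultrafilter.of_le atTop
  have hpos : ∀ᶠ T in (U : Filter ℝ), 0 < T := hU (eventually_gt_atTop 0)
  obtain ⟨w, hw, hw0, hbal⟩ := hp.exists_limit U hU
  set c := Q.hold 0
  have hc : ∀ n, c ≤ Q.costRate n (d n) := fun n =>
    (hh.increasing n.zero_le).trans (hold_le_costRate n _)
  have hsum' : ∀ t, 0 ≤ t →
      HasSum (fun n => p t n * (Q.costRate n (d n) - c))
        (∑' n, p t n * Q.costRate n (d n) - c) := fun t ht => by
    have := (hsum t ht).hasSum.sub ((hp.hasSum_one t ht).mul_right c)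
    rw [one_mul] at this
    simpa only [mul_sub] using this
  -- Passes a bound valid at each time to the limit of the time averages. It is used for Fatou's
  -- inequality (`hcost`) and for tightness (`htight`).
  have havg : ∀ (s : Finset ℕ) (g : ℕ → ℝ) (e : ℝ),
      (∀ t, 0 ≤ t → ∑ n ∈ s, p t n * g n ≤ ∑' n, p t n * Q.costRate n (d n) + e) →
      ∑ n ∈ s, w n * g n ≤ η + e := by
    intro s g e hle
    have h1 : Tendsto (fun T => ∑ n ∈ s, timeAverage p T n * g n) U (𝓝 (∑ n ∈ s, w n * g n)) :=
      tendsto_finsetSum _ fun n _ => (hw n).mul_const _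
    refine le_of_tendsto_of_tendsto h1 ((hlim.mono_left hU).add_const e) ?_
    filter_upwards [hpos] with T hT
    have h2 : ∫ t in (0 : ℝ)..T, ∑ n ∈ s, p t n * g n
        ≤ ∫ t in (0 : ℝ)..T, (∑' n, p t n * Q.costRate n (d n) + e) :=
      intervalIntegral.integral_mono_on hT.le
        (hp.intervalIntegrable_sum_mul hT.le s g)
        ((hint T hT.le).add intervalIntegrable_const) fun t ht => hle t ht.1
    rw [intervalIntegral.integral_finsetSum
        fun n _ => (hp.intervalIntegrable hT.le n).mul_const _,
      intervalIntegral.integral_add (hint T hT.le) intervalIntegrable_const,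
      intervalIntegral.integral_const, sub_zero, smul_eq_mul] at h2
    have h3 := mul_le_mul_of_nonneg_left h2 (inv_nonneg.2 hT.le)
    rw [mul_add, inv_mul_cancel_left₀ hT.ne', Finset.mul_sum] at h3
    refine le_trans (le_of_eq (Finset.sum_congr rfl fun n _ => ?_)) h3
    rw [intervalIntegral.integral_mul_const]
    unfold timeAverage
    ring
  have hcost : ∀ s : Finset ℕ, ∑ n ∈ s, w n * (Q.costRate n (d n) - c) ≤ η - c := by
    intro s
    rw [sub_eq_add_neg η]
    refine havg s _ (-c) fun t ht => ?_
    rw [← sub_eq_add_neg]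
    exact sum_le_hasSum s (fun n _ => mul_nonneg (hp.nonneg t ht n) (sub_nonneg.2 (hc n)))
      (hsum' t ht)
  have hmass : ∀ s : Finset ℕ, ∑ n ∈ s, w n ≤ 1 := by
    intro s
    refine le_of_tendsto (tendsto_finsetSum s fun n _ => hw n) ?_
    filter_upwards [hpos] with T hT
    have h2 : ∫ t in (0 : ℝ)..T, ∑ n ∈ s, p t n ≤ ∫ _ in (0 : ℝ)..T, (1 : ℝ) :=
      intervalIntegral.integral_mono_on hT.le
        (by simpa using hp.intervalIntegrable_sum_mul hT.le s fun _ => 1)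
        intervalIntegrable_const fun t ht =>
          sum_le_hasSum s (fun n _ => hp.nonneg t ht.1 n) (hp.hasSum_one t ht.1)
    rw [intervalIntegral.integral_finsetSum fun n _ => hp.intervalIntegrable hT.le n,
      intervalIntegral.integral_const, sub_zero, smul_eq_mul, mul_one] at h2
    unfold timeAverage
    rw [← Finset.mul_sum, inv_mul_le_iff₀ hT, mul_one]
    exact h2
  have hws : Summable w := summable_of_sum_le hw0 hmass
  -- Markov's inequality: mass in the states from `N` on costs at least `hold N`.
  have htight : ∀ N, (Q.hold N - c) * (1 - ∑ n ∈ Finset.range N, w n) ≤ η - c := by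
    intro N
    have := havg (Finset.range N) (fun _ => -(Q.hold N - c)) (-c - (Q.hold N - c)) fun t ht => by
      have h1 : HasSum (fun n => p t n * (Q.hold N - c)) (Q.hold N - c) := by
        simpa using (hp.hasSum_one t ht).mul_right (Q.hold N - c)
      have h2 : HasSum (fun n => if n ∈ Finset.range N then p t n * (Q.hold N - c) else 0)
          (∑ n ∈ Finset.range N, p t n * (Q.hold N - c)) := by
        rw [← Finset.sum_congr rfl fun n hn => if_pos hn]
        exact hasSum_sum_of_ne_finset_zero fun n hn => if_neg hn
      have h3 : HasSum (fun n => p t n * (Q.hold N - c)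
          - if n ∈ Finset.range N then p t n * (Q.hold N - c) else 0)
          ((Q.hold N - c) - ∑ n ∈ Finset.range N, p t n * (Q.hold N - c)) :=
        h1.sub h2
      have hle : ∀ n, p t n * (Q.hold N - c)
          - (if n ∈ Finset.range N then p t n * (Q.hold N - c) else 0)
          ≤ p t n * (Q.costRate n (d n) - c) := fun n => by
        have hpn := hp.nonneg t ht n
        split_ifs with hn
        · rw [sub_self]
          exact mul_nonneg hpn (sub_nonneg.2 (hc n))
        · rw [sub_zero]
          refine mul_le_mul_of_nonneg_left (sub_le_sub_right ?_ _) hpn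
          exact (hh.increasing (by simpa using hn)).trans (hold_le_costRate n _)
      have h4 := hasSum_le hle h3 (hsum' t ht)
      simp only [mul_neg, Finset.sum_neg_distrib]
      linarith
    rw [← Finset.sum_mul] at this
    linarith
  have hone : ∑' n, w n = 1 := by
    refine le_antisymm (hws.tsum_le_of_sum_le hmass) ?_
    by_contra! hlt
    have h1 : ∀ N, (Q.hold N - c) * (1 - ∑' n, w n) ≤ η - c := fun N =>
      (mul_le_mul_of_nonneg_left
        (sub_le_sub_left (hws.sum_le_tsum _ fun n _ => hw0 n) 1)
        (sub_nonneg.2 (hh.increasing N.zero_le))).trans (htight N)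
    have h2 : Tendsto (fun N => (Q.hold N - c) * (1 - ∑' n, w n)) atTop atTop :=
      (tendsto_atTop_add_const_right _ (-c) hh.tendsto).atTop_mul_const (sub_pos.2 hlt)
    obtain ⟨N, hN⟩ := (h2.eventually_gt_atTop (η - c)).exists
    exact absurd (h1 N) (not_le.2 hN)
  have hone' : HasSum w 1 := hone ▸ hws.hasSum
  have hfs : Summable fun n => w n * (Q.costRate n (d n) - c) :=
    summable_of_sum_le (fun n => mul_nonneg (hw0 n) (sub_nonneg.2 (hc n))) hcost
  have hfs' : HasSum (fun n => w n * Q.costRate n (d n))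
      (∑' n, w n * (Q.costRate n (d n) - c) + 1 * c) := by
    refine (hfs.hasSum.add (hone'.mul_right c)).congr_fun ?_
    intro n
    ring
  refine ⟨w, ⟨hw0, hone', hbal⟩, hfs'.summable, ?_⟩
  rw [hfs'.tsum_eq]
  linarith [hfs.tsum_le_of_sum_le hcost]

end GroupServerQueue

/-! ### Performance differences and policy improvement -/

namespace GroupServerQueue

variable {K : ℕ} (Q : GroupServerQueue K)

/-- The rate at which the action `m` saves costs, when each departure saves the amount `x`. -/
noncomputable def gain (m : Fin K → ℕ) (x : ℝ) : ℝ :=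
  ∑ k, (m k : ℝ) * (Q.rate k * x - Q.opCost k)

/-- The efficient actions in state `n`. -/
def feasibleActions (n : ℕ) : Finset (Fin K → ℕ) :=
  (Fintype.piFinset fun k => Finset.range (Q.servers k + 1)).filter fun m => ∑ k, m k ≤ n

/-- The differences `G (n + 1) = V (n + 1) - V n` of the relative values of the policy `d` of
average cost `η`, from the Poisson equation. -/
noncomputable def valueDiff (d : ℕ → Fin K → ℕ) (η : ℝ) : ℕ → ℝ
  -- There is no departure from state 0; the value 0 cancels the service rate prescribed there,
  -- which the generator ignores as well.
  | 0 => 0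
  | n + 1 => (η - Q.hold n + Q.gain (d n) (valueDiff d η n)) / Q.arrival

variable {Q} {d d' : ℕ → Fin K → ℕ} {w : ℕ → ℝ} {η : ℝ}

lemma mem_feasibleActions {n : ℕ} {m : Fin K → ℕ} :
    m ∈ Q.feasibleActions n ↔ (∀ k, m k ≤ Q.servers k) ∧ ∑ k, m k ≤ n := by
  simp [feasibleActions]

lemma zero_mem_feasibleActions (n : ℕ) : (0 : Fin K → ℕ) ∈ Q.feasibleActions n := by
  simp [mem_feasibleActions]

lemma IsEfficient.mem (hd : Q.IsEfficient d) (n : ℕ) : d n ∈ Q.feasibleActions n :=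
  mem_feasibleActions.2 (hd n)

lemma gain_eq (n : ℕ) (m : Fin K → ℕ) (x : ℝ) :
    Q.gain m x = Q.serviceRate m * x - (Q.costRate n m - Q.hold n) := by
  unfold gain serviceRate costRate
  rw [add_sub_cancel_left, Finset.sum_mul, ← Finset.sum_sub_distrib]
  exact Finset.sum_congr rfl fun k _ => by ring

@[simp] lemma gain_zero (x : ℝ) : Q.gain 0 x = 0 := by simp [gain]

lemma gain_mono (m : Fin K → ℕ) : Monotone (Q.gain m) := fun _ _ hxy =>
  Finset.sum_le_sum fun k _ => mul_le_mul_of_nonneg_left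
    (sub_le_sub_right (mul_le_mul_of_nonneg_left hxy (Q.rate_pos k).le) _) (Nat.cast_nonneg _)

lemma arrival_mul_valueDiff (n : ℕ) : Q.arrival * Q.valueDiff d η (n + 1)
    = η - Q.hold n + Q.gain (d n) (Q.valueDiff d η n) := by
  have := Q.arrival_pos.ne'
  rw [valueDiff]
  field_simp

/-- The performance difference formula, on an initial segment of the states. -/
lemma sum_range_mul_costRate_sub {v : ℕ → ℝ}
    (hv : ∀ n, Q.serviceRate (d' (n + 1)) * v (n + 1) = Q.arrival * v n) (N : ℕ) :
    ∑ j ∈ Finset.range (N + 1), v j * (Q.costRate j (d' j) - η)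
      = ∑ j ∈ Finset.range (N + 1), v j * (Q.gain (d j) (Q.valueDiff d η j)
          - Q.gain (d' j) (Q.valueDiff d η j))
        - v N * (Q.arrival * Q.valueDiff d η (N + 1)) := by
  induction N with
  | zero =>
    rw [arrival_mul_valueDiff]
    simp only [zero_add, Finset.sum_range_one, valueDiff, gain_eq 0]
    ring
  | succ N ih =>
    rw [Finset.sum_range_succ, ih, Finset.sum_range_succ _ (N + 1), arrival_mul_valueDiff (N + 1),
      gain_eq (N + 1) (d' (N + 1))]
    linear_combination (Q.valueDiff d η (N + 1)) * hv N

lemma hasSum_mul_costRate_sub (hw : Q.IsStationary d w)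
    (hf : Summable fun n => w n * Q.costRate n (d n)) (e : ℝ) :
    HasSum (fun n => w n * (Q.costRate n (d n) - e)) (∑' n, w n * Q.costRate n (d n) - e) := by
  have := hf.hasSum.sub (hw.hasSum_one.mul_right e)
  rw [one_mul] at this
  simpa only [mul_sub] using this

/-- With `d' = d` only the boundary term of the performance difference formula remains, and the left
side sums to 0. -/
lemma tendsto_mul_valueDiff (hw : Q.IsStationary d w)
    (hf : Summable fun n => w n * Q.costRate n (d n))
    (hη : ∑' n, w n * Q.costRate n (d n) = η) :
    Tendsto (fun N => w N * (Q.arrival * Q.valueDiff d η (N + 1))) atTop (𝓝 0) := by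
  have h1 := hasSum_mul_costRate_sub hw hf η
  rw [hη, sub_self] at h1
  have h2 := (tendsto_add_atTop_iff_nat 1).2 h1.tendsto_sum_nat
  have h3 := h2.neg
  rw [neg_zero] at h3
  refine h3.congr fun N => ?_
  rw [sum_range_mul_costRate_sub (d := d) (η := η) hw.balance]
  simp

/-- The series of `w n * (cost - η)` has sum 0 and eventually nonnegative terms, so its partial sums
are eventually nonpositive; they equal minus the boundary term. -/
lemma eventually_valueDiff_nonneg (hh : Q.HoldingCostAssumption) (hw : Q.IsStationary d w)
    (hf : Summable fun n => w n * Q.costRate n (d n))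
    (hη : ∑' n, w n * Q.costRate n (d n) = η) :
    ∀ᶠ n in atTop, 0 ≤ Q.valueDiff d η (n + 1) := by
  obtain ⟨b, -, hb⟩ := hw.exists_first_pos
  obtain ⟨N, hN⟩ := eventually_atTop.1 (hh.tendsto.eventually_ge_atTop η)
  have h1 := hasSum_mul_costRate_sub hw hf η
  rw [hη, sub_self] at h1
  have hterm : ∀ n, N ≤ n → 0 ≤ w n * (Q.costRate n (d n) - η) := fun n hn =>
    mul_nonneg (hw.nonneg n) (sub_nonneg.2 ((hN n hn).trans (hold_le_costRate n _)))
  filter_upwards [eventually_ge_atTop (max N b)] with n hn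
  have hNn : N ≤ n := (le_max_left _ _).trans hn
  have h2 : ∑ j ∈ Finset.range (n + 1), w j * (Q.costRate j (d j) - η) ≤ 0 :=
    sum_le_hasSum _ (fun j hj => hterm j (hNn.trans (by
      have := Finset.mem_range.not.1 hj
      omega))) h1
  rw [sum_range_mul_costRate_sub (d := d) (η := η) hw.balance] at h2
  simp only [sub_self, mul_zero, Finset.sum_const_zero, zero_sub, Left.neg_nonpos_iff] at h2
  exact nonneg_of_mul_nonneg_right (nonneg_of_mul_nonneg_right h2
    (hb n ((le_max_right _ _).trans hn))) Q.arrival_pos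

/-- Extension of `w N` to the left of the state `N`, by the balance equations of `d`: the value in
state `N - i`. -/
noncomputable def balanceBack (Q : GroupServerQueue K) (d : ℕ → Fin K → ℕ) (N : ℕ) (x : ℝ) : ℕ → ℝ
  | 0 => x
  | i + 1 => Q.serviceRate (d (N - i)) * balanceBack Q d N x i / Q.arrival

lemma balanceBack_nonneg (N : ℕ) {x : ℝ} (hx : 0 ≤ x) (i : ℕ) : 0 ≤ Q.balanceBack d N x i := by
  induction i with
  | zero => exact hx
  | succ i ih => exact div_nonneg (mul_nonneg (serviceRate_nonneg _) ih) Q.arrival_pos.le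

/-- A change of rates in finitely many states preserves positive recurrence, and changes the
stationary distribution on the remaining states by a constant factor only. -/
lemma IsStationary.exists_of_eq_above (hw : Q.IsStationary d w) {N : ℕ} (hN : 0 < w N)
    (hr : ∀ n, N < n → Q.serviceRate (d' n) = Q.serviceRate (d n)) :
    ∃ v c, Q.IsStationary d' v ∧ 0 < c ∧ ∀ n, N ≤ n → v n = c * w n := by
  let u : ℕ → ℝ := fun n => if N ≤ n then w n else Q.balanceBack d' N (w N) (N - n)
  have hu0 : ∀ n, 0 ≤ u n := fun n => by
    simp only [u]
    split_ifs
    · exact hw.nonneg n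
    · exact balanceBack_nonneg N (hw.nonneg N) _
  have huN : ∀ n, N ≤ n → u n = w n := fun n hn => if_pos hn
  have hus : Summable u := by
    refine (summable_nat_add_iff N).1 (((summable_nat_add_iff N).2 hw.hasSum_one.summable).congr
      fun n => ?_)
    exact (huN _ (Nat.le_add_left _ _)).symm
  have hub : ∀ n, Q.serviceRate (d' (n + 1)) * u (n + 1) = Q.arrival * u n := by
    intro n
    rcases le_or_gt N n with hn | hn
    · rw [huN n hn, huN (n + 1) (by omega), hr (n + 1) (by omega), hw.balance]
    · have h1 : u (n + 1) = Q.balanceBack d' N (w N) (N - (n + 1)) := by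
        rcases (Nat.succ_le_of_lt hn).eq_or_lt with h | h
        · rw [Nat.succ_eq_add_one] at h
          rw [h, huN N le_rfl, Nat.sub_self, balanceBack]
        · exact if_neg (by omega)
      have h2 : u n = Q.balanceBack d' N (w N) (N - (n + 1) + 1) := by
        rw [show N - (n + 1) + 1 = N - n by omega]
        exact if_neg (by omega)
      rw [h1, h2, balanceBack, show N - (N - (n + 1)) = n + 1 by omega,
        mul_div_cancel₀ _ Q.arrival_pos.ne']
  have hZ : 0 < ∑' n, u n := hus.tsum_pos hu0 N (by rwa [huN N le_rfl])
  refine ⟨fun n => (∑' n, u n)⁻¹ * u n, (∑' n, u n)⁻¹,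
    ⟨fun n => mul_nonneg (inv_nonneg.2 hZ.le) (hu0 n), ?_, fun n => ?_⟩, inv_pos.2 hZ,
    fun n hn => congrArg _ (huN n hn)⟩
  · have := hus.hasSum.mul_left (∑' n, u n)⁻¹
    rwa [inv_mul_cancel₀ hZ.ne'] at this
  · rw [mul_left_comm, hub, mul_left_comm]

/-- The performance difference formula, for policies that have the same rates in all but finitely
many states. -/
lemma exists_isStationary_performance_difference (hw : Q.IsStationary d w)
    (hf : Summable fun n => w n * Q.costRate n (d n))
    (hη : ∑' n, w n * Q.costRate n (d n) = η) {N : ℕ} (hN : 0 < w N)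
    (hr : ∀ n, N < n → Q.serviceRate (d' n) = Q.serviceRate (d n))
    (hc : ∀ n, N < n → Q.costRate n (d' n) = Q.costRate n (d n)) :
    ∃ v, Q.IsStationary d' v ∧ Summable (fun n => v n * Q.costRate n (d' n)) ∧ 0 < v N ∧
      ∑' n, v n * Q.costRate n (d' n) - η = ∑ j ∈ Finset.range (N + 1),
        v j * (Q.gain (d j) (Q.valueDiff d η j) - Q.gain (d' j) (Q.valueDiff d η j)) := by
  obtain ⟨v, c, hv, hc0, hvw⟩ := hw.exists_of_eq_above hN hr
  have hvs : Summable fun n => v n * Q.costRate n (d' n) := by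
    refine (summable_nat_add_iff (N + 1)).1
      ((((summable_nat_add_iff (N + 1)).2 hf).mul_left c).congr fun n => ?_)
    rw [hvw _ (by omega), hc _ (by omega), mul_assoc]
  refine ⟨v, hv, hvs, by rw [hvw N le_rfl]; exact mul_pos hc0 hN, ?_⟩
  set D : ℕ → ℝ := fun j =>
    v j * (Q.gain (d j) (Q.valueDiff d η j) - Q.gain (d' j) (Q.valueDiff d η j))
  have hD : ∀ j, j ∉ Finset.range (N + 1) → D j = 0 := fun j hj => by
    have hj : N < j := by
      have := Finset.mem_range.not.1 hj
      omega
    simp only [D]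
    rw [gain_eq j, gain_eq j, hr j hj, hc j hj, sub_self, mul_zero]
  have h1 := (tendsto_add_atTop_iff_nat 1).2 (hasSum_mul_costRate_sub hv hvs η).tendsto_sum_nat
  have h2 := (tendsto_add_atTop_iff_nat 1).2
    (hasSum_sum_of_ne_finset_zero (f := D) hD).tendsto_sum_nat
  -- From `N` on, `v` is a multiple of `w`, so the boundary term vanishes as it does for `d`.
  have h3 : Tendsto (fun M => v M * (Q.arrival * Q.valueDiff d η (M + 1))) atTop (𝓝 0) := by
    have := (tendsto_mul_valueDiff hw hf hη).const_mul c
    rw [mul_zero] at this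
    refine this.congr' ?_
    filter_upwards [eventually_ge_atTop N] with M hM
    rw [hvw M hM, mul_assoc]
  have h4 := h2.sub h3
  rw [sub_zero] at h4
  refine tendsto_nhds_unique h1 (h4.congr fun M => ?_)
  exact (sum_range_mul_costRate_sub hv.balance M).symm

variable (Q d w) in
/-- The policy `d` has stationary distribution `w`, with the smallest mean cost of all efficient
policies. -/
structure IsOptimalWith : Prop where
  efficient : Q.IsEfficient d
  stationary : Q.IsStationary d w
  summable : Summable fun n => w n * Q.costRate n (d n)
  le : ∀ d' w', Q.IsEfficient d' → Q.IsStationary d' w' →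
    (Summable fun n => w' n * Q.costRate n (d' n)) →
    ∑' n, w n * Q.costRate n (d n) ≤ ∑' n, w' n * Q.costRate n (d' n)

lemma IsOptimal.exists_isOptimalWith (hh : Q.HoldingCostAssumption) (h : Q.IsOptimal d) :
    ∃ w, Q.IsOptimalWith d w := by
  obtain ⟨hd, η, hη, hmin⟩ := h
  obtain ⟨w, hw, hf, hle⟩ := hη.exists_isStationary hh
  exact ⟨w, hd, hw, hf, fun d' w' hd' hw' hf' =>
    hle.trans (hmin d' _ hd' (hw'.hasAverageCost hd' hf'))⟩

namespace IsOptimalWith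

lemma isOptimal (hh : Q.HoldingCostAssumption) (h : Q.IsOptimalWith d w) : Q.IsOptimal d := by
  refine ⟨h.efficient, _, h.stationary.hasAverageCost h.efficient h.summable,
    fun d' η' hd' hη' => ?_⟩
  obtain ⟨w', hw', hf', hle⟩ := hη'.exists_isStationary hh
  exact (h.le d' w' hd' hw' hf').trans hle

/-- Policy improvement: the optimal action maximizes the gain, in each recurrent state. -/
lemma gain_le (h : Q.IsOptimalWith d w) (hη : ∑' n, w n * Q.costRate n (d n) = η) {n : ℕ}
    (hn : 0 < w n) {m : Fin K → ℕ} (hm : m ∈ Q.feasibleActions n) :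
    Q.gain m (Q.valueDiff d η n) ≤ Q.gain (d n) (Q.valueDiff d η n) := by
  -- The action is changed in state `n` only, so a single term of the performance difference
  -- remains.
  have hne : ∀ j, n < j → Function.update d n m j = d j := fun j hj =>
    Function.update_of_ne hj.ne' _ _
  obtain ⟨v, hv, hvs, hvn, hdiff⟩ := exists_isStationary_performance_difference
    (d' := Function.update d n m) h.stationary h.summable hη hn
    (fun j hj => by rw [hne j hj]) (fun j hj => by rw [hne j hj])
  have heff : Q.IsEfficient (Function.update d n m) := fun j => by
    rcases eq_or_ne j n with rfl | hj
    · rw [Function.update_self]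
      exact mem_feasibleActions.1 hm
    · rw [Function.update_of_ne hj]
      exact h.efficient j
  have hle := h.le _ v heff hv hvs
  rw [hη] at hle
  rw [Finset.sum_range_succ, Finset.sum_eq_zero fun j hj => by
    rw [Function.update_of_ne (Finset.mem_range.1 hj).ne, sub_self, mul_zero],
    Function.update_self, zero_add] at hdiff
  rw [← sub_nonneg]
  refine nonneg_of_mul_nonneg_right (a := v n) ?_ hvn
  rw [← hdiff]
  linarith

/-- The actions in the transient states are immaterial. -/
lemma idle_below (h : Q.IsOptimalWith d w) {b : ℕ} (hb0 : ∀ n, n < b → w n = 0) (hb : 0 < w b) :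
    Q.IsOptimalWith (fun n => if n ≤ b then 0 else d n) w := by
  have hdb := h.stationary.policy_first_pos_eq_zero h.efficient hb0 hb
  have heq : ∀ n, w n * Q.costRate n (if n ≤ b then 0 else d n) = w n * Q.costRate n (d n) := by
    intro n
    rcases lt_trichotomy n b with hn | rfl | hn
    · rw [hb0 n hn, zero_mul, zero_mul]
    · rw [if_pos le_rfl, hdb]
    · rw [if_neg (by omega)]
  refine ⟨fun n => ?_, ⟨h.stationary.nonneg, h.stationary.hasSum_one, fun n => ?_⟩, ?_, ?_⟩
  · split_ifs
    · simp
    · exact h.efficient n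
  · have := h.stationary.balance n
    split_ifs with hn
    · rw [hb0 n (by omega), serviceRate_zero, zero_mul, mul_zero]
    · exact this
  · simpa only [heq] using h.summable
  · simpa only [heq] using h.le

end IsOptimalWith

/-- The largest gain of an efficient action in state `n`. -/
noncomputable def maxGain (Q : GroupServerQueue K) (n : ℕ) (x : ℝ) : ℝ :=
  (Q.feasibleActions n).sup' ⟨0, zero_mem_feasibleActions n⟩ fun m => Q.gain m x

/-! ### The optimality equation and the growth of the value differences -/

section MaxGain

variable {n : ℕ} {x y : ℝ} {m : Fin K → ℕ}

lemma gain_le_maxGain (hm : m ∈ Q.feasibleActions n) : Q.gain m x ≤ Q.maxGain n x :=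
  Finset.le_sup' (fun m => Q.gain m x) hm

lemma exists_gain_eq_maxGain (n : ℕ) (x : ℝ) :
    ∃ m ∈ Q.feasibleActions n, Q.gain m x = Q.maxGain n x := by
  obtain ⟨m, hm, h⟩ := Finset.exists_mem_eq_sup' ⟨0, zero_mem_feasibleActions (Q := Q) n⟩
    fun m => Q.gain m x
  exact ⟨m, hm, h.symm⟩

lemma maxGain_eq (hm : m ∈ Q.feasibleActions n)
    (h : ∀ m' ∈ Q.feasibleActions n, Q.gain m' x ≤ Q.gain m x) : Q.maxGain n x = Q.gain m x :=
  le_antisymm (Finset.sup'_le _ _ h) (gain_le_maxGain hm)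

lemma maxGain_nonneg (n : ℕ) (x : ℝ) : 0 ≤ Q.maxGain n x := by
  simpa using gain_le_maxGain (x := x) (zero_mem_feasibleActions (Q := Q) n)

lemma maxGain_mono (n : ℕ) : Monotone (Q.maxGain n) := fun _ _ hxy =>
  Finset.sup'_le _ _ fun m hm => (gain_mono m hxy).trans (gain_le_maxGain hm)

lemma maxGain_zero (x : ℝ) : Q.maxGain 0 x = 0 := by
  obtain ⟨m, hm, h⟩ := exists_gain_eq_maxGain (Q := Q) 0 x
  have : m = 0 := by
    have := (mem_feasibleActions.1 hm).2
    simpa [funext_iff] using this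
  rw [← h, this, gain_zero]

lemma maxGain_le (n : ℕ) (x : ℝ) :
    Q.maxGain n x ≤ ∑ k, (Q.servers k : ℝ) * |Q.rate k * x - Q.opCost k| :=
  Finset.sup'_le _ _ fun _ hm => Finset.sum_le_sum fun k _ =>
    (mul_le_mul_of_nonneg_left (le_abs_self _) (Nat.cast_nonneg _)).trans
      (mul_le_mul_of_nonneg_right (Nat.cast_le.2 ((mem_feasibleActions.1 hm).1 k)) (abs_nonneg _))

lemma gain_add_single (m : Fin K → ℕ) (k : Fin K) (x : ℝ) :
    Q.gain (m + Pi.single k 1) x = Q.gain m x + (Q.rate k * x - Q.opCost k) := by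
  unfold gain
  simp only [Pi.add_apply, Nat.cast_add, add_mul, Finset.sum_add_distrib]
  congr 1
  rw [Finset.sum_eq_single k]
  · simp
  · intro j _ hj
    simp [hj]
  · simp

lemma sum_add_single (m : Fin K → ℕ) (k : Fin K) :
    ∑ j, (m + Pi.single k 1 : Fin K → ℕ) j = ∑ j, m j + 1 := by
  simp [Finset.sum_add_distrib]

lemma add_single_mem (hm : m ∈ Q.feasibleActions n) {k : Fin K} (hk : m k < Q.servers k) :
    m + Pi.single k 1 ∈ Q.feasibleActions (n + 1) := by
  obtain ⟨h1, h2⟩ := mem_feasibleActions.1 hm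
  refine mem_feasibleActions.2 ⟨fun j => ?_, ?_⟩
  · rcases eq_or_ne j k with rfl | hj
    · simpa using hk
    · simpa [hj] using h1 j
  · rw [sum_add_single]
    omega

lemma mem_of_add_single_mem {k : Fin K} (hm : m + Pi.single k 1 ∈ Q.feasibleActions (n + 1)) :
    m ∈ Q.feasibleActions n := by
  obtain ⟨h1, h2⟩ := mem_feasibleActions.1 hm
  rw [sum_add_single] at h2
  exact mem_feasibleActions.2 ⟨fun j => le_trans (by simp) (h1 j), by omega⟩

lemma exists_eq_add_single {k : Fin K} (hk : 0 < m k) : ∃ m' : Fin K → ℕ, m = m' + Pi.single k 1 := by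
  refine ⟨m - Pi.single k 1, (tsub_add_cancel_of_le ?_).symm⟩
  intro j
  rcases eq_or_ne j k with rfl | hj
  · simpa using Nat.succ_le_of_lt hk
  · simp [hj]

/-- The marginal gain of a further customer is nonincreasing in the number of customers, and
nondecreasing in the value of a departure. -/
lemma maxGain_add_le (n : ℕ) (hxy : x ≤ y) :
    Q.maxGain (n + 2) x + Q.maxGain n y ≤ Q.maxGain (n + 1) x + Q.maxGain (n + 1) y := by
  obtain ⟨m, hm, hmx⟩ := exists_gain_eq_maxGain (Q := Q) (n + 2) x
  obtain ⟨l, hl, hly⟩ := exists_gain_eq_maxGain (Q := Q) n y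
  obtain ⟨hm1, hm2⟩ := mem_feasibleActions.1 hm
  obtain ⟨hl1, hl2⟩ := mem_feasibleActions.1 hl
  rw [← hmx, ← hly]
  rcases le_or_gt (∑ k, m k) (n + 1) with h | h
  · exact add_le_add (gain_le_maxGain (mem_feasibleActions.2 ⟨hm1, h⟩))
      (gain_le_maxGain (mem_feasibleActions.2 ⟨hl1, by omega⟩))
  -- Here `m` has more working servers than `l`; one of a group `k` with `l k < m k` is moved from
  -- `m` to `l`, where it gains at least as much because `x ≤ y`.
  · obtain ⟨k, -, hk⟩ := Finset.exists_lt_of_sum_lt (show ∑ k, l k < ∑ k, m k by omega)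
    obtain ⟨m', rfl⟩ := exists_eq_add_single (m := m) (k := k) (by omega)
    have h1 : Q.gain m' x ≤ _ := gain_le_maxGain (mem_of_add_single_mem hm)
    have h2 : Q.gain (l + Pi.single k 1) y ≤ _ :=
      gain_le_maxGain (add_single_mem hl (hk.trans_le (hm1 k)))
    rw [gain_add_single] at h2 ⊢
    have h3 := mul_le_mul_of_nonneg_left hxy (Q.rate_pos k).le
    linarith

/-- A solution of the optimality equation that does not increase at some point, while the marginal
gain does not exceed the increment of the holding cost, is eventually negative. -/
lemma false_of_valueDiff_le (hh : Q.HoldingCostAssumption) {G : ℕ → ℝ} {b : ℕ}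
    (hG : ∀ j, b < j → Q.arrival * G (j + 1) = η - Q.hold j + Q.maxGain j (G j))
    (hpos : ∀ᶠ n in atTop, 0 ≤ G (n + 1)) (hle : G (b + 2) ≤ G (b + 1))
    (hmarg : Q.maxGain (b + 1) (G (b + 1)) - Q.maxGain b (G (b + 1))
      ≤ Q.hold (b + 1) - Q.hold b) : False := by
  -- Both inequalities are needed to reproduce each other: the marginal gain can only fall along
  -- nonincreasing values, while the increment of `hold` can only grow.
  have hstep : ∀ j, b ≤ j → G (j + 2) ≤ G (j + 1) ∧
      Q.maxGain (j + 1) (G (j + 1)) - Q.maxGain j (G (j + 1)) ≤ Q.hold (j + 1) - Q.hold j := by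
    intro j hj
    induction j, hj using Nat.le_induction with
    | base => exact ⟨hle, hmarg⟩
    | succ j hj ih =>
      obtain ⟨ih1, ih2⟩ := ih
      have h1 := maxGain_add_le (Q := Q) j ih1
      have h2 := hh.convex j
      have h3 : Q.arrival * G (j + 3) = _ := hG (j + 2) (by omega)
      have h4 : Q.arrival * G (j + 2) = _ := hG (j + 1) (by omega)
      have h5 := maxGain_mono (Q := Q) (j + 1) ih1
      refine ⟨le_of_mul_le_mul_left ?_ Q.arrival_pos, ?_⟩
      · change Q.arrival * G (j + 3) ≤ Q.arrival * G (j + 2)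
        linarith
      · change Q.maxGain (j + 2) (G (j + 2)) - Q.maxGain (j + 1) (G (j + 2))
          ≤ Q.hold (j + 2) - Q.hold (j + 1)
        linarith
  have hanti : ∀ j, b ≤ j → G (j + 1) ≤ G (b + 1) := by
    intro j hj
    induction j, hj using Nat.le_induction with
    | base => exact le_rfl
    | succ j hj ih => exact (hstep j hj).1.trans ih
  set D := ∑ k, (Q.servers k : ℝ) * |Q.rate k * G (b + 1) - Q.opCost k|
  obtain ⟨n, hn, hnb, hn0⟩ := ((hh.tendsto.eventually_gt_atTop (η + D)).and
    ((eventually_gt_atTop b).and hpos)).exists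
  have h1 := hG n hnb
  have h2 : Q.maxGain n (G n) ≤ D := by
    obtain ⟨j, rfl⟩ : ∃ j, n = j + 1 := ⟨n - 1, by omega⟩
    exact (maxGain_mono _ (hanti j (by omega))).trans (maxGain_le _ _)
  have h3 := mul_nonneg Q.arrival_pos.le hn0
  linarith

end MaxGain

namespace IsOptimalWith

lemma arrival_mul_valueDiff_eq (h : Q.IsOptimalWith d w)
    (hη : ∑' n, w n * Q.costRate n (d n) = η) {n : ℕ} (hn : 0 < w n) :
    Q.arrival * Q.valueDiff d η (n + 1)
      = η - Q.hold n + Q.maxGain n (Q.valueDiff d η n) := by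
  rw [arrival_mul_valueDiff, maxGain_eq (h.efficient.mem n) fun m hm => h.gain_le hη hn hm]

/-- An optimal policy never idles while customers are present: all states are recurrent. -/
lemma pos (hh : Q.HoldingCostAssumption) (h : Q.IsOptimalWith d w) (n : ℕ) : 0 < w n := by
  obtain ⟨b, hb0, hb⟩ := h.stationary.exists_first_pos
  cases b with
  | zero => exact hb n n.zero_le
  | succ b =>
    exfalso
    -- Idling in the states up to the first recurrent state `b + 1` makes `G (b + 2)` and `G (b +
    -- 1)` differ only by the holding costs, so that `G` fails to increase there.
    have h' := h.idle_below hb0 (hb _ le_rfl)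
    set d₀ : ℕ → Fin K → ℕ := fun n => if n ≤ b + 1 then 0 else d n
    obtain ⟨η, hη⟩ : ∃ η, ∑' n, w n * Q.costRate n (d₀ n) = η := ⟨_, rfl⟩
    have hz : ∀ j, j ≤ b + 1 → d₀ j = 0 := fun j hj => if_pos hj
    have h1 : Q.arrival * Q.valueDiff d₀ η (b + 2) = _ := arrival_mul_valueDiff (b + 1)
    have h2 : Q.arrival * Q.valueDiff d₀ η (b + 1) = _ := arrival_mul_valueDiff b
    rw [hz _ le_rfl, gain_zero] at h1
    rw [hz _ b.le_succ, gain_zero] at h2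
    have h3 := hh.increasing b.le_succ
    rw [Nat.succ_eq_add_one] at h3
    refine false_of_valueDiff_le hh (G := Q.valueDiff d₀ η) (b := b)
      (fun j hj => h'.arrival_mul_valueDiff_eq hη (hb j hj))
      (eventually_valueDiff_nonneg hh h'.stationary h'.summable hη)
      (le_of_mul_le_mul_left (by linarith) Q.arrival_pos) ?_
    have h4 : Q.maxGain (b + 1) (Q.valueDiff d₀ η (b + 1)) = 0 := by
      rw [maxGain_eq (h'.efficient.mem _) fun m hm => h'.gain_le hη (hb _ le_rfl) hm,
        hz _ le_rfl, gain_zero]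
    have h5 := maxGain_nonneg (Q := Q) b (Q.valueDiff d₀ η (b + 1))
    linarith

/-- This is strict convexity of the relative value function. At the first failure, the optimality
equations of two neighbouring states yield the bound on the marginal gain that
`false_of_valueDiff_le` requires. -/
lemma valueDiff_lt_succ (hh : Q.HoldingCostAssumption) (h : Q.IsOptimalWith d w)
    (hη : ∑' n, w n * Q.costRate n (d n) = η) (n : ℕ) :
    Q.valueDiff d η (n + 1) < Q.valueDiff d η (n + 2) := by
  classical
  have hG := fun j => h.arrival_mul_valueDiff_eq hη (h.pos hh j)
  by_contra! hn
  have hex : ∃ n, Q.valueDiff d η (n + 2) ≤ Q.valueDiff d η (n + 1) := ⟨n, hn⟩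
  have hb := Nat.find_spec hex
  have hmin := fun j => Nat.find_min hex (m := j)
  set b := Nat.find hex
  refine false_of_valueDiff_le hh (b := b) (fun j _ => hG j)
    (eventually_valueDiff_nonneg hh h.stationary h.summable hη) hb ?_
  have h1 : Q.arrival * Q.valueDiff d η (b + 2) = _ := hG (b + 1)
  have h2 := hG b
  have h3 : Q.maxGain b (Q.valueDiff d η b) ≤ Q.maxGain b (Q.valueDiff d η (b + 1)) := by
    -- The default `valueDiff d η 0 = 0` is not compared with the next value; in state 0 the maximal
    -- gain is 0 in any case.
    rcases Nat.eq_zero_or_pos b with h0 | h0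
    · rw [h0, maxGain_zero, maxGain_zero]
    · obtain ⟨c, hc⟩ : ∃ c, b = c + 1 := ⟨b - 1, by omega⟩
      have := hmin c (by omega)
      rw [hc]
      exact maxGain_mono _ (le_of_not_ge this)
  have h4 := mul_le_mul_of_nonneg_left hb Q.arrival_pos.le
  linarith

lemma valueDiff_strictMono (hh : Q.HoldingCostAssumption) (h : Q.IsOptimalWith d w)
    (hη : ∑' n, w n * Q.costRate n (d n) = η) :
    StrictMono fun n => Q.valueDiff d η (n + 1) :=
  strictMono_nat_of_lt_succ (h.valueDiff_lt_succ hh hη)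

end IsOptimalWith

end GroupServerQueue

/-! ### Exchange of servers and resolution of ties -/

namespace GroupServerQueue

variable {K : ℕ} {Q : GroupServerQueue K} {d : ℕ → Fin K → ℕ} {n : ℕ} {x y : ℝ}
  {a a' m : Fin K → ℕ}

variable (Q) in
/-- The action `m` maximizes the gain in state `n`, when each departure saves the amount `x`. -/
def IsMaximizer (n : ℕ) (x : ℝ) (m : Fin K → ℕ) : Prop :=
  m ∈ Q.feasibleActions n ∧ ∀ m' ∈ Q.feasibleActions n, Q.gain m' x ≤ Q.gain m x

variable (Q) in
/-- The action `m` resolves ties between groups with equal ratios by their numbering. -/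
def ActionBreaksTies (m : Fin K → ℕ) : Prop :=
  ∀ k l, k < l → Q.opCost k / Q.rate k = Q.opCost l / Q.rate l → 0 < m l → m k = Q.servers k

lemma feasibleActions_mono {l : ℕ} (h : n ≤ l) (hm : m ∈ Q.feasibleActions n) :
    m ∈ Q.feasibleActions l :=
  mem_feasibleActions.2 ⟨(mem_feasibleActions.1 hm).1, (mem_feasibleActions.1 hm).2.trans h⟩

lemma rate_mul_sub_opCost (k : Fin K) (x : ℝ) :
    Q.rate k * x - Q.opCost k = Q.rate k * (x - Q.opCost k / Q.rate k) := by
  have := (Q.rate_pos k).ne'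
  field_simp

/-- Once group `k` is profitable, both factors of its gain `rate * (x - ratio)` are at least those
of `l`; so `l` can match it only with the same ratio. -/
lemma ScaleEconomies.ratio_eq (hs : Q.ScaleEconomies) {k l : Fin K} (hkl : k ≤ l)
    (hx : Q.opCost k / Q.rate k ≤ x)
    (h : Q.rate k * x - Q.opCost k ≤ Q.rate l * x - Q.opCost l) :
    Q.opCost k / Q.rate k = Q.opCost l / Q.rate l := by
  rw [rate_mul_sub_opCost, rate_mul_sub_opCost] at h
  have h1 := mul_le_mul_of_nonneg_right (hs.rate_descending k l hkl) (sub_nonneg.2 hx)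
  have h2 := le_of_mul_le_mul_left (h1.trans h) (Q.rate_pos l)
  exact le_antisymm (hs.ratio_ascending k l hkl) (by linarith)

lemma sum_pos_of_mem {k : Fin K} (hm : m + Pi.single k 1 ∈ Q.feasibleActions n) :
    ∃ n', n = n' + 1 := by
  have := (mem_feasibleActions.1 hm).2
  rw [sum_add_single] at this
  exact ⟨n - 1, by omega⟩

/-- Removing a working server from an optimal action is not an improvement. -/
lemma IsMaximizer.ratio_le {k : Fin K} (h : Q.IsMaximizer n x (m + Pi.single k 1)) :
    Q.opCost k / Q.rate k ≤ x := by
  obtain ⟨n', rfl⟩ := sum_pos_of_mem h.1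
  have h1 := h.2 m (feasibleActions_mono n'.le_succ (mem_of_add_single_mem h.1))
  rw [gain_add_single, rate_mul_sub_opCost, le_add_iff_nonneg_right] at h1
  exact sub_nonneg.1 (nonneg_of_mul_nonneg_right h1 (Q.rate_pos k))

lemma swap_mem {k l : Fin K} (hkl : k ≠ l) (hm : m + Pi.single l 1 ∈ Q.feasibleActions n)
    (hk : (m + Pi.single l 1 : Fin K → ℕ) k < Q.servers k) :
    m + Pi.single k 1 ∈ Q.feasibleActions n := by
  obtain ⟨n', rfl⟩ := sum_pos_of_mem hm
  refine add_single_mem (mem_of_add_single_mem hm) ?_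
  simpa [hkl] using hk

/-- Replacing a working server of an optimal action by an idle one is not an improvement. -/
lemma IsMaximizer.swap_le {k l : Fin K} (hkl : k ≠ l)
    (h : Q.IsMaximizer n x (m + Pi.single l 1))
    (hk : (m + Pi.single l 1 : Fin K → ℕ) k < Q.servers k) :
    Q.rate k * x - Q.opCost k ≤ Q.rate l * x - Q.opCost l := by
  have h1 := h.2 _ (swap_mem hkl h.1 hk)
  rwa [gain_add_single, gain_add_single, add_le_add_iff_left] at h1

/-- Optimal actions that resolve ties are nondecreasing, when the value of a departure increases
with the number of customers. -/
lemma IsMaximizer.le_of_lt (hs : Q.ScaleEconomies) (hxy : x < y) (ha : Q.IsMaximizer n x a)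
    (hta : Q.ActionBreaksTies a) (ha' : Q.IsMaximizer (n + 1) y a')
    (hta' : Q.ActionBreaksTies a') : a ≤ a' := by
  intro k
  refine not_lt.1 fun (hk : a' k < a k) => ?_
  obtain ⟨hfa, hfa'⟩ := mem_feasibleActions.1 ha.1
  obtain ⟨hga, hga'⟩ := mem_feasibleActions.1 ha'.1
  obtain ⟨b, hb⟩ := exists_eq_add_single (m := a) (k := k) (by omega)
  have hxk : Q.opCost k / Q.rate k ≤ x := (hb ▸ ha).ratio_le
  have hk' : a' k < Q.servers k := hk.trans_le (hfa k)
  -- If `a'` leaves a customer unserved, switching on a server of group `k` gains strictly, since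
  -- its ratio is at most `x < y`. Otherwise `a'` has more working servers than `a`, hence more in
  -- some group `l`.
  rcases le_or_gt (∑ j, a' j) n with h | h
  · have h1 := ha'.2 _ (add_single_mem (mem_feasibleActions.2 ⟨hga, h⟩) hk')
    rw [gain_add_single, rate_mul_sub_opCost] at h1
    have h2 := mul_pos (Q.rate_pos k) (sub_pos.2 (hxk.trans_lt hxy))
    linarith
  · obtain ⟨l, -, hl⟩ := Finset.exists_lt_of_sum_lt (show ∑ j, a j < ∑ j, a' j by omega)
    obtain ⟨b', hb'⟩ := exists_eq_add_single (m := a') (k := l) (by omega)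
    have hkl : k ≠ l := by
      rintro rfl
      omega
    have hal : a l < Q.servers l := hl.trans_le (hga l)
    -- The swap towards the smaller number takes place in `a'` if `k < l` and in `a` if `l < k`;
    -- optimality forces equal ratios, and the tie rule contradicts the idle server.
    rcases hkl.lt_or_gt with hlt | hlt
    · have h1 := IsMaximizer.swap_le hkl (hb' ▸ ha') (hb' ▸ hk')
      have h2 := hta' k l hlt (hs.ratio_eq hlt.le (hxk.trans hxy.le) h1) (by omega)
      omega
    · have h1 := IsMaximizer.swap_le hkl.symm (hb ▸ ha) (hb ▸ hal)
      have h2 := hta l k hlt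
        (hs.ratio_eq hlt.le ((hs.ratio_ascending l k hlt.le).trans hxk) h1) (by omega)
      omega

lemma serviceRate_add_single (m : Fin K → ℕ) (k : Fin K) :
    Q.serviceRate (m + Pi.single k 1) = Q.serviceRate m + Q.rate k := by
  -- The gain is affine in the value of a departure with slope `serviceRate`, so the values at 0 and
  -- 1 suffice.
  have h0 := gain_add_single (Q := Q) m k 0
  have h1 := gain_add_single (Q := Q) m k 1
  rw [gain_eq 0, gain_eq 0 m] at h0 h1
  linarith

/-- Ties can be resolved without loss; the service rate changes only if some ratio equals the value
of a departure. -/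
lemma IsMaximizer.exists_breaksTies (hs : Q.ScaleEconomies) (ha : Q.IsMaximizer n x a) :
    ∃ m, Q.IsMaximizer n x m ∧ Q.ActionBreaksTies m ∧
      ((∀ k, Q.opCost k / Q.rate k ≠ x) → Q.serviceRate m = Q.serviceRate a) := by
  classical
  -- Among the admissible maximizers, one of least index sum is taken: moving a server to a group of
  -- smaller number lowers this sum.
  obtain ⟨m, hm, hmin⟩ := Finset.exists_min_image
    ((Q.feasibleActions n).filter fun m => Q.IsMaximizer n x m ∧
      ((∀ k, Q.opCost k / Q.rate k ≠ x) → Q.serviceRate m = Q.serviceRate a))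
    (fun m => ∑ j : Fin K, (j : ℕ) * m j)
    ⟨a, Finset.mem_filter.2 ⟨ha.1, ha, fun _ => rfl⟩⟩
  obtain ⟨-, hmax, hrate⟩ := Finset.mem_filter.1 hm
  refine ⟨m, hmax, fun k l hkl hr hl => ?_, hrate⟩
  by_contra hk
  have hk : m k < Q.servers k := lt_of_le_of_ne ((mem_feasibleActions.1 hmax.1).1 k) hk
  obtain ⟨b, rfl⟩ := exists_eq_add_single hl
  have hmem := swap_mem hkl.ne hmax.1 hk
  have hxl := hmax.ratio_le
  have hle := hmax.swap_le hkl.ne hk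
  have hge : Q.rate l * x - Q.opCost l ≤ Q.rate k * x - Q.opCost k := by
    rw [rate_mul_sub_opCost, rate_mul_sub_opCost, hr]
    exact mul_le_mul_of_nonneg_right (hs.rate_descending k l hkl.le) (sub_nonneg.2 hxl)
  have heq := le_antisymm hle hge
  have hgain : Q.gain (b + Pi.single k 1) x = Q.gain (b + Pi.single l 1) x := by
    rw [gain_add_single, gain_add_single, heq]
  have h1 := hmin (b + Pi.single k 1) (Finset.mem_filter.2 ⟨hmem, ⟨hmem, fun m' hm' =>
    (hmax.2 m' hm').trans hgain.ge⟩, fun hne => by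
      -- Equal gains with a common nonzero margin `x - ratio` force equal service rates.
      rw [← hrate hne, serviceRate_add_single, serviceRate_add_single]
      rw [rate_mul_sub_opCost, rate_mul_sub_opCost, hr] at heq
      rw [mul_right_cancel₀ (sub_ne_zero.2 (hne l).symm) heq]⟩)
  have h2 : ∀ i : Fin K, ∑ j : Fin K, (j : ℕ) * (b + Pi.single i 1 : Fin K → ℕ) j
      = ∑ j : Fin K, (j : ℕ) * b j + i := by
    intro i
    simp only [Pi.add_apply, mul_add, Finset.sum_add_distrib]
    congr 1
    rw [Finset.sum_eq_single i]
    · simp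
    · intro j _ hj
      simp [hj]
    · simp
  rw [h2, h2] at h1
  have : (k : ℕ) < l := hkl
  omega

lemma IsOptimalWith.isMaximizer {w : ℕ → ℝ} {η : ℝ} (hh : Q.HoldingCostAssumption)
    (h : Q.IsOptimalWith d w) (hη : ∑' n, w n * Q.costRate n (d n) = η) (n : ℕ) :
    Q.IsMaximizer n (Q.valueDiff d η n) (d n) :=
  ⟨h.efficient.mem n, fun _ hm => h.gain_le hη (h.pos hh n) hm⟩

/-- Optimal policies that resolve ties by the numbering of the groups are nondecreasing in the
number of customers. -/
theorem IsOptimal.monotone (hh : Q.HoldingCostAssumption) (hs : Q.ScaleEconomies)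
    (h : Q.IsOptimal d) (ht : Q.BreaksRatioTies d) : Monotone d := by
  obtain ⟨w, hw⟩ := h.exists_isOptimalWith hh
  refine monotone_nat_of_le_succ fun n => ?_
  cases n with
  | zero =>
    rw [hw.efficient.zero]
    exact zero_le
  | succ n =>
    exact IsMaximizer.le_of_lt hs (hw.valueDiff_lt_succ hh rfl n) (hw.isMaximizer hh rfl (n + 1))
      (ht (n + 1)) (hw.isMaximizer hh rfl (n + 2)) (ht (n + 2))

theorem IsOptimal.exists_breaksRatioTies (hh : Q.HoldingCostAssumption) (hs : Q.ScaleEconomies)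
    (h : Q.IsOptimal d) : ∃ d', Q.IsOptimal d' ∧ Q.BreaksRatioTies d' := by
  obtain ⟨w, hw⟩ := h.exists_isOptimalWith hh
  obtain ⟨η, hη⟩ : ∃ η, ∑' n, w n * Q.costRate n (d n) = η := ⟨_, rfl⟩
  choose d' hmax htie hrate using fun n => (hw.isMaximizer hh hη n).exists_breaksTies hs
  refine ⟨d', ?_, htie⟩
  have hgain : ∀ n, Q.gain (d' n) (Q.valueDiff d η n) = Q.gain (d n) (Q.valueDiff d η n) :=
    fun n => le_antisymm ((hw.isMaximizer hh hη n).2 _ (hmax n).1)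
      ((hmax n).2 _ (hw.efficient.mem n))
  -- The new policy may differ from `d` in infinitely many states, but its rates can differ only
  -- where the value of a departure hits a ratio. Each ratio is hit at most once from state 1 on, by
  -- strict monotonicity.
  have hfin : {n | Q.valueDiff d η (n + 1) ∈ Set.range fun k => Q.opCost k / Q.rate k}.Finite :=
    (Set.finite_range _).preimage (hw.valueDiff_strictMono hh hη).injective.injOn
  obtain ⟨N, hN⟩ := hfin.bddAbove
  have hr : ∀ n, N + 1 < n → Q.serviceRate (d' n) = Q.serviceRate (d n) := by
    intro n hn
    obtain ⟨j, rfl⟩ : ∃ j, n = j + 1 := ⟨n - 1, by omega⟩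
    refine hrate _ fun k hk => ?_
    have : j ≤ N := hN ⟨k, hk⟩
    omega
  have hc : ∀ n, N + 1 < n → Q.costRate n (d' n) = Q.costRate n (d n) := by
    intro n hn
    have := hgain n
    rw [gain_eq n, gain_eq n, hr n hn] at this
    linarith
  obtain ⟨v, hv, hvs, -, hdiff⟩ := exists_isStationary_performance_difference hw.stationary
    hw.summable hη (hw.pos hh (N + 1)) hr hc
  -- Both actions maximize the same gain in every state, so the performance difference is 0.
  rw [Finset.sum_eq_zero fun j _ => by rw [hgain, sub_self, mul_zero], sub_eq_zero, ← hη] at hdiff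
  refine IsOptimalWith.isOptimal (w := v) hh
    ⟨fun n => mem_feasibleActions.1 (hmax n).1, hv, hvs, ?_⟩
  rw [hdiff]
  exact hw.le

end GroupServerQueue

theorem theorem8 {K : ℕ} (Q : GroupServerQueue K) (hhold : Q.HoldingCostAssumption)
    (hscale : Q.ScaleEconomies) :
    (∀ d : ℕ → Fin K → ℕ, Q.IsOptimal d → Q.BreaksRatioTies d →
      (∀ k : Fin K, Monotone fun n => d n k) ∧ Monotone d) ∧
    ((∃ d : ℕ → Fin K → ℕ, Q.IsOptimal d) →
      ∃ d : ℕ → Fin K → ℕ, Q.IsOptimal d ∧ Q.BreaksRatioTies d) := by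
  refine ⟨fun d hd ht => ?_, fun ⟨d, hd⟩ => hd.exists_breaksRatioTies hhold hscale⟩
  have hmono := hd.monotone hhold hscale ht
  exact ⟨fun k i j hij => hmono hij k, hmono⟩
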